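/- **Setting.** $K$ users share a block-fading TDMA uplink. The fading state $\mathbf h=(h_1,\dots,h_K)$ is a random vector with nonnegative entries whose law is absolutely continuous with respect to Lebesgue measure on $\mathbb R^K$. User $k$ has $M_k\ge 1$ AMC modes $(\rho_{k,l},p_{k,l})$, $1\le l\le M_k$ (rate, minimum received power), and the silent mode $(\rho_{k,0},p_{k,0})=(0,0)$, where $0=\rho_{k,0}<\rho_{k,1}<\dots<\rho_{k,M_k}$, $p_{k,l}>0$ for $l\ge1$, and the slopes $\gamma_{k,l}=(p_{k,l}-p_{k,l-1})/(\rho_{k,l}-\rho_{k,l-1})$ are nondecreasing in $l$. Let $\Upsilon_k(r)=p_{k,l-1}/h_k+\gamma_{k,l}(r-\rho_{k,l-1})/h_k$ for $\rho_{k,l-1}\le r\le\rho_{k,l}$, $1\le l\le M_k$, and $\Upsilon_k(r)=\infty$ for $r>\rho_{k,M_k}$. Power weights $\mu_k>0$ are given. For a vector $\bar{\mathbf r}=(\bar R_1,\dots,\bar R_K)$ of rate requirements consider, over measurable policies, the problems (P1) minimize $\sum_k E_{\mathbf h}\big[\sum_{l=0}^{M_k}\mu_k\tilde\tau_{k,l}(\mathbf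 h)p_{k,l}/h_k\big]$ subject to $\tilde\tau_{k,l}\ge0$, $\sum_k\sum_{l=0}^{M_k}\tilde\tau_{k,l}(\mathbf h)=1$ for all $\mathbf h$, and $E_{\mathbf h}\big[\sum_{l=0}^{M_k}\tilde\tau_{k,l}(\mathbf h)\rho_{k,l}\big]\ge\bar R_k$ for all $k$; (P2) minimize $E_{\mathbf h}\big[\sum_k\mu_k\tau_k(\mathbf h)\Upsilon_k(r_k(\mathbf h))\big]$ subject to $r_k,\tau_k\ge0$, $\sum_k\tau_k(\mathbf h)=1$ for all $\mathbf h$, and $E_{\mathbf h}[\tau_k(\mathbf h)r_k(\mathbf h)]\ge\bar R_k$ for all $k$. Call $\bar{\mathbf r}$ strictly feasible if some policy in (P1) satisfies all rate constraints with strict inequality. For $\boldsymbol\lambda=(\lambda_1,\dots,\lambda_K)$ with all $\lambda_k>0$ and a state $\mathbf h$ with positive entries, let $l_k^*=\max\{l\in[1,M_k]:\mu_k\gamma_{k,l}/h_k\le\lambda_k\}$ ($l_k^*=0$ if there is no such $l$), $C_{k,l}=\mu_kp_{k,l}/h_k$ and $\varphi_k(\mathbf h)=C_{k,l_k^*}-\lambda_k\rho_{k,l_k^*}$.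 A *greedy policy* for $\boldsymbol\lambda$ is a measurable policy $\tilde\tau$ that, in every state $\mathbf h$ with positive entries, gives time only to users minimizing $\varphi_k(\mathbf h)$, each in its mode $l_k^*$: a single minimizer $i$ gets $\tilde\tau_{i,l_i^*}=1$; several minimizers share the time in arbitrary fractions with sum 1. It induces $r_k^*=\rho_{k,l_k^*}$ for minimizing users, $r_k^*=0$ for the others, and $\tau_k^*=\sum_l\tilde\tau_{k,l}$. Write $\boldsymbol\lambda\in\Lambda(\bar{\mathbf r})$ if all $\lambda_k>0$ and some greedy policy for $\boldsymbol\lambda$ satisfies $E_{\mathbf h}[\tau_k^*(\mathbf h)r_k^*(\mathbf h)]=\bar R_k$ for all $k$. *Iterative algorithm.* Start from any $\boldsymbol\lambda(0)$ with positive entries; given $\boldsymbol\lambda(n)$, for each $k$ choose $\lambda_k(n+1)>0$ such that user $k$ has average rate $\bar R_k$ under the greedy policy when the weights of all other users are those of $\boldsymbol\lambda(n)$. **Theorem 6.** 1. For every $\bar{\mathbf r}$ and $\boldsymbol\lambda^*\in\Lambda(\bar{\mathbf r})$, every greedy policy for $\boldsymbol\lambda^*$ has average rates exactly $\bar{\mathbf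 r}$ and is optimal for (P1), and the induced $(\mathbf r^*,\boldsymbol\tau^*)$ is optimal for (P2); both minima are finite. 2. If $\bar R_k>0$ for all $k$ and $\bar{\mathbf r}$ is strictly feasible, then $\Lambda(\bar{\mathbf r})\neq\emptyset$. 3. For Lebesgue-almost every such $\bar{\mathbf r}$, the vector $\boldsymbol\lambda^*\in\Lambda(\bar{\mathbf r})$ is unique. If moreover the law of $\mathbf h$ gives positive probability to every nonempty open subset of $(0,\infty)^K$, then $\boldsymbol\lambda^*$ is unique for every such $\bar{\mathbf r}$, and in the iterative algorithm each update $\lambda_k(n+1)$ exists and is unique. 4. For every such $\bar{\mathbf r}$ and every positive $\boldsymbol\lambda(0)$ the iterative algorithm can be run, and if $\Lambda(\bar{\mathbf r})=\{\boldsymbol\lambda^*\}$, then every run satisfies $\boldsymbol\lambda(n)\to\boldsymbol\lambda^*$ as $n\to\infty$. -/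

import Mathlib

open MeasureTheory Filter Topology
open scoped ENNReal

noncomputable section

/-- A (joint) fading state `h = (h_1, …, h_K)`, or any other vector with one entry per user. -/
abbrev UserVec (K : ℕ) := Fin K → ℝ

/-- Incremental power per unit of rate, `γ_l = (p_l - p_{l-1}) / (ρ_l - ρ_{l-1})`, for `l ≥ 1`. -/
def modeSlope (rho p : ℕ → ℝ) (l : ℕ) : ℝ :=
  (p l - p (l - 1)) / (rho l - rho (l - 1))

/-- The AMC modes of `K` users. User `k` has `M k ≥ 1` modes `(rho k l, p k l)`, `1 ≤ l ≤ M k`,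
and the silent mode `(rho k 0, p k 0) = (0, 0)`; entries with `l > M k` are never used. Rates
are strictly increasing in `l`, required received powers are positive, and the piecewise linear
power-rate curve is convex (its slopes are nondecreasing). -/
structure AMCModes (K : ℕ) where
  M : Fin K → ℕ
  rho : Fin K → ℕ → ℝ
  p : Fin K → ℕ → ℝ
  one_le_M : ∀ k, 1 ≤ M k
  rho_zero : ∀ k, rho k 0 = 0
  p_zero : ∀ k, p k 0 = 0
  rho_lt : ∀ k l, l < M k → rho k l < rho k (l + 1)
  p_pos : ∀ k l, 1 ≤ l → l ≤ M k → 0 < p k l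
  slope_le : ∀ k l, 1 ≤ l → l < M k →
    modeSlope (rho k) (p k) l ≤ modeSlope (rho k) (p k) (l + 1)

namespace AMCModes

variable {K : ℕ} (A : AMCModes K)

/-- `γ_{k,l}`. -/
def gam (k : Fin K) (l : ℕ) : ℝ := modeSlope (A.rho k) (A.p k) l

/-- Transmit power `Υ_k(r)` needed by user `k` for rate `r ≥ 0` when its channel gain is `g`:
if `ρ_{k,l-1} ≤ r ≤ ρ_{k,l}` it is `p_{k,l-1}/g + γ_{k,l} (r - ρ_{k,l-1})/g`, and it is `∞` if
`r > ρ_{k,M_k}`. -/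
def upsilon (k : Fin K) (g r : ℝ) : ℝ≥0∞ :=
  let l := sInf {l : ℕ | 1 ≤ l ∧ r ≤ A.rho k l}
  if r ≤ A.rho k (A.M k) then
    ENNReal.ofReal (A.p k (l - 1) / g + A.gam k l * (r - A.rho k (l - 1)) / g)
  else ⊤

/-! ### Allocation over users and modes -/

/-- A time allocation over users and modes: in state `h`, user `k` uses its mode `l` for the
fraction `t h k l` of the block, `0 ≤ l ≤ M k`. -/
structure IsModePolicy (t : UserVec K → Fin K → ℕ → ℝ) : Prop where
  measurable : ∀ k l, Measurable fun h => t h k l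
  nonneg : ∀ h, (∀ k, 0 < h k) → ∀ k, ∀ l ≤ A.M k, 0 ≤ t h k l
  sum_eq_one : ∀ h, (∀ k, 0 < h k) → ∑ k, ∑ l ∈ Finset.range (A.M k + 1), t h k l = 1

/-- Average rate `E_h[∑_l t_{k,l}(h) ρ_{k,l}]` of user `k` (a bounded integrand). -/
def avgRate (F : Measure (UserVec K)) (t : UserVec K → Fin K → ℕ → ℝ) (k : Fin K) : ℝ :=
  ∫ h, ∑ l ∈ Finset.range (A.M k + 1), t h k l * A.rho k l ∂F

/-- Weighted average power `∑_k E_h[∑_l μ_k t_{k,l}(h) p_{k,l} / h_k]`, possibly infinite. -/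
def modeCost (F : Measure (UserVec K)) (mu : UserVec K)
    (t : UserVec K → Fin K → ℕ → ℝ) : ℝ≥0∞ :=
  ∑ k, ∫⁻ h, ENNReal.ofReal
    (∑ l ∈ Finset.range (A.M k + 1), mu k * (t h k l / h k) * A.p k l) ∂F

/-- Feasible points of the mode allocation problem with rate requirements `R`. -/
def IsFeasibleModes (F : Measure (UserVec K)) (R : UserVec K)
    (t : UserVec K → Fin K → ℕ → ℝ) : Prop :=
  A.IsModePolicy t ∧ ∀ k, R k ≤ A.avgRate F t k

/-- `t` solves the mode allocation problem (with a finite optimal value). -/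
def IsOptimalModes (F : Measure (UserVec K)) (mu R : UserVec K)
    (t : UserVec K → Fin K → ℕ → ℝ) : Prop :=
  A.IsFeasibleModes F R t ∧ A.modeCost F mu t ≠ ⊤ ∧
    ∀ t', A.IsFeasibleModes F R t' → A.modeCost F mu t ≤ A.modeCost F mu t'

/-- The rate vector `R` is strictly feasible: some allocation exceeds every requirement. -/
def StrictlyFeasible (F : Measure (UserVec K)) (R : UserVec K) : Prop :=
  ∃ t, A.IsModePolicy t ∧ ∀ k, R k < A.avgRate F t k

/-! ### Allocation through rates and time fractions -/

/-- Feasible points `(r, τ)` of the rate and time allocation problem with requirements `R`. -/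
structure IsFeasibleAlloc (F : Measure (UserVec K)) (R : UserVec K)
    (r tau : UserVec K → UserVec K) : Prop where
  measurable_rate : Measurable r
  measurable_time : Measurable tau
  rate_nonneg : ∀ h, (∀ k, 0 < h k) → ∀ k, 0 ≤ r h k
  time_nonneg : ∀ h, (∀ k, 0 < h k) → ∀ k, 0 ≤ tau h k
  sum_eq_one : ∀ h, (∀ k, 0 < h k) → ∑ k, tau h k = 1
  rate_le : ∀ k, ENNReal.ofReal (R k) ≤ ∫⁻ h, ENNReal.ofReal (tau h k * r h k) ∂F

/-- Weighted average power `E_h[∑_k μ_k τ_k(h) Υ_k(r_k(h))]`, possibly infinite. -/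
def allocCost (F : Measure (UserVec K)) (mu : UserVec K)
    (r tau : UserVec K → UserVec K) : ℝ≥0∞ :=
  ∫⁻ h, ∑ k, ENNReal.ofReal (mu k * tau h k) * A.upsilon k (h k) (r h k) ∂F

/-- `(r, τ)` solves the rate and time allocation problem (with a finite optimal value). -/
def IsOptimalAlloc (F : Measure (UserVec K)) (mu R : UserVec K)
    (r tau : UserVec K → UserVec K) : Prop :=
  IsFeasibleAlloc F R r tau ∧ A.allocCost F mu r tau ≠ ⊤ ∧
    ∀ r' tau', IsFeasibleAlloc F R r' tau' →
      A.allocCost F mu r tau ≤ A.allocCost F mu r' tau'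

/-! ### Greedy policies -/

/-- `l_k^* = max {l ∈ [1, M_k] : μ_k γ_{k,l} / h_k ≤ λ_k}`, and `0` if there is no such `l`. -/
def lstar (mu lam h : UserVec K) (k : Fin K) : ℕ :=
  ((Finset.Icc 1 (A.M k)).filter fun l => mu k * A.gam k l / h k ≤ lam k).sup id

/-- `φ_k(h) = μ_k p_{k,l_k^*} / h_k - λ_k ρ_{k,l_k^*}`. -/
def quality (mu lam h : UserVec K) (k : Fin K) : ℝ :=
  mu k * A.p k (A.lstar mu lam h k) / h k - lam k * A.rho k (A.lstar mu lam h k)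

/-- User `k` minimizes `φ` in state `h`. -/
def IsBest (mu lam h : UserVec K) (k : Fin K) : Prop :=
  ∀ j, A.quality mu lam h k ≤ A.quality mu lam h j

/-- The greedy allocations for the multiplier vector `lam`: in each state, only users minimizing
`φ_k(h)` get time, each only in its mode `l_k^*`; several minimizers share time arbitrarily. -/
def IsGreedy (mu lam : UserVec K) (t : UserVec K → Fin K → ℕ → ℝ) : Prop :=
  A.IsModePolicy t ∧ ∀ h, (∀ k, 0 < h k) → ∀ k, ∀ l ≤ A.M k,
    ¬ (A.IsBest mu lam h k ∧ l = A.lstar mu lam h k) → t h k l = 0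

open Classical in
/-- The rates of a greedy policy: `ρ_{k,l_k^*}` for the users minimizing `φ`, `0` for others. -/
def greedyRate (mu lam h : UserVec K) (k : Fin K) : ℝ :=
  if A.IsBest mu lam h k then A.rho k (A.lstar mu lam h k) else 0

/-- The total time fractions given to the users by an allocation over modes. -/
def userTime (t : UserVec K → Fin K → ℕ → ℝ) (h : UserVec K) (k : Fin K) : ℝ :=
  ∑ l ∈ Finset.range (A.M k + 1), t h k l

/-- `lam` is an admissible multiplier vector `λ^*` for `R`: it is positive and, for some time
sharing among best users, the greedy policy has average rates exactly `R`. -/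
def IsMultiplier (F : Measure (UserVec K)) (mu R lam : UserVec K) : Prop :=
  (∀ k, 0 < lam k) ∧ ∃ t, A.IsGreedy mu lam t ∧ ∀ k, A.avgRate F t k = R k

/-- One coordinate of one step of the iterative algorithm: `x > 0` is a weight for user `k` with
which, the weights of the other users being those of `lam`, user `k` has average rate `R k`
under the greedy policy. -/
def IsStep (F : Measure (UserVec K)) (mu R lam : UserVec K) (k : Fin K) (x : ℝ) : Prop :=
  0 < x ∧ ∃ t, A.IsGreedy mu (Function.update lam k x) t ∧ A.avgRate F t k = R k

/-- `s` is a run of the iterative algorithm started at `lam0`: all users' weights are updated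
simultaneously, each against the previous weights of the others. -/
def IsRun (F : Measure (UserVec K)) (mu R lam0 : UserVec K) (s : ℕ → UserVec K) : Prop :=
  s 0 = lam0 ∧ ∀ n k, A.IsStep F mu R (s n) k (s (n + 1) k)

end AMCModes

/-- Every nonempty open set of positive fading states has positive probability. -/
def ChargesOpenSets {K : ℕ} (F : Measure (UserVec K)) : Prop :=
  ∀ U : Set (UserVec K), IsOpen U → U.Nonempty → (∀ h ∈ U, ∀ k, 0 < h k) → 0 < F U

end

/-! ### Modes -/

namespace AMCModes

variable {K : ℕ} (A : AMCModes K) {mu lam lam' h h' : UserVec K} {k : Fin K} {l m : ℕ}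

/-! The proof is Lagrangian duality combined with a monotone fixed-point argument. For weights
`lam`, mode `l` of user `k` has Lagrangian cost `μp/h - λρ` in state `h`. Convexity of the
power-rate curve makes `lstar` a cheapest mode (`quality_le`). With `gain` the largest `-φ_k`,
weighted rate is at most power plus gain in each state (`sum_rate_le`, and `mul_rate_le` for
arbitrary rates), with equality for greedy policies (`sum_rate_eq`). Integrating, a greedy policy
whose rates are exactly `R` is optimal in both problems.

Absolute continuity makes almost every state regular (`ae_isRegular`): ties then occur only among
silent users. Hence all greedy policies for `lam` share the average rates `meanRate`, and
multipliers are the positive solutions of `meanRate lam = R` (`isMultiplier_iff`). This map is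
continuous, increasing in a user's own weight, decreasing in the others' weights (both weakly), and
zero at weight zero. These properties (`IsResponse`) suffice to solve a complementarity problem in
any box (`exists_mem_Icc`), hence to find solutions below supersolutions and above subsolutions.
Arbitrarily large supersolutions exist because strict feasibility gives `∑ R k / rhoMax k < 1`
(`exists_le_meanRate`).

A multiplier maximizes the dual function `∑ λR - meanGain λ` over positive weights, so it is a
subgradient of the dual value, a convex function of `R`. Almost everywhere differentiability makes
it unique for almost every `R`. If the law charges open sets, a nonempty open set of states where
only one of two weight vectors leaves everybody silent makes the dual comparison strict
(`exists_isOpen_lstar`).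

For the iteration, a strict supersolution bounds the run; its coordinatewise upper limit is a
subsolution and its lower limit a supersolution. A solution lies above the former and another below
the latter, so uniqueness squeezes both limits together (`tendsto_run`). -/

theorem rho_strictMono (hlm : l < m) (hm : m ≤ A.M k) : A.rho k l < A.rho k m := by
  induction m, hlm using Nat.le_induction with
  | base => exact A.rho_lt k l (by omega)
  | succ n hn ih => exact (ih (by omega)).trans (A.rho_lt k n (by omega))

theorem rho_mono (hlm : l ≤ m) (hm : m ≤ A.M k) : A.rho k l ≤ A.rho k m := by
  rcases hlm.eq_or_lt with rfl | hlt
  · exact le_rfl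
  · exact (A.rho_strictMono hlt hm).le

theorem rho_nonneg (hl : l ≤ A.M k) : 0 ≤ A.rho k l := by
  rw [← A.rho_zero k]; exact A.rho_mono (Nat.zero_le l) hl

theorem rho_pos (hl : 1 ≤ l) (hM : l ≤ A.M k) : 0 < A.rho k l := by
  rw [← A.rho_zero k]; exact A.rho_strictMono hl hM

/-- The largest rate of user `k`. -/
def rhoMax (k : Fin K) : ℝ := A.rho k (A.M k)

theorem rhoMax_pos (k : Fin K) : 0 < A.rhoMax k := A.rho_pos (A.one_le_M k) le_rfl

theorem rho_le_rhoMax (hl : l ≤ A.M k) : A.rho k l ≤ A.rhoMax k := A.rho_mono hl le_rfl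

theorem p_nonneg (hl : l ≤ A.M k) : 0 ≤ A.p k l := by
  rcases Nat.eq_zero_or_pos l with rfl | h0
  · exact (A.p_zero k).ge
  · exact (A.p_pos k l h0 hl).le

theorem gam_mono (hl : 1 ≤ l) (hlm : l ≤ m) (hm : m ≤ A.M k) : A.gam k l ≤ A.gam k m := by
  induction m, hlm using Nat.le_induction with
  | base => exact le_rfl
  | succ n hn ih => exact (ih (by omega)).trans (A.slope_le k n (by omega) (by omega))

theorem gam_pos (hl : 1 ≤ l) (hM : l ≤ A.M k) : 0 < A.gam k l := by
  refine lt_of_lt_of_le ?_ (A.gam_mono le_rfl hl hM)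
  have h1 := A.rho_pos (k := k) le_rfl (A.one_le_M k)
  have h2 := A.p_pos k 1 le_rfl (A.one_le_M k)
  simp only [gam, modeSlope, Nat.sub_self, A.rho_zero, A.p_zero, sub_zero]
  positivity

theorem p_succ (hl : l < A.M k) :
    A.p k (l + 1) = A.p k l + A.gam k (l + 1) * (A.rho k (l + 1) - A.rho k l) := by
  have := sub_pos.2 (A.rho_lt k l hl)
  simp only [gam, modeSlope, Nat.add_sub_cancel]
  field_simp
  ring

/-! ### The greedy mode and the quality of a user -/

theorem lstar_le_M : A.lstar mu lam h k ≤ A.M k :=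
  Finset.sup_le fun _ hl => (Finset.mem_Icc.1 (Finset.mem_filter.1 hl).1).2

theorem le_lstar (hl : 1 ≤ l) (hM : l ≤ A.M k) (hle : mu k * A.gam k l / h k ≤ lam k) :
    l ≤ A.lstar mu lam h k :=
  Finset.le_sup (f := id) (Finset.mem_filter.2 ⟨Finset.mem_Icc.2 ⟨hl, hM⟩, hle⟩)

theorem lstar_spec (hpos : 1 ≤ A.lstar mu lam h k) :
    mu k * A.gam k (A.lstar mu lam h k) / h k ≤ lam k := by
  have hne : ((Finset.Icc 1 (A.M k)).filter fun l => mu k * A.gam k l / h k ≤ lam k).Nonempty := by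
    by_contra hne
    rw [Finset.not_nonempty_iff_eq_empty] at hne
    simp [lstar, hne] at hpos
  obtain ⟨l, hl, hle⟩ := Finset.exists_mem_eq_sup _ hne id
  have h2 : A.lstar mu lam h k = l := hle
  rw [h2]
  exact (Finset.mem_filter.1 hl).2

/-- Slopes are nondecreasing, so the modes whose threshold lies below the weight form an initial
segment, and their maximum determines them all. -/
theorem le_lstar_iff (hmu : 0 < mu k) (hh : 0 < h k) (hl : 1 ≤ l) (hM : l ≤ A.M k) :
    l ≤ A.lstar mu lam h k ↔ mu k * A.gam k l / h k ≤ lam k := by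
  refine ⟨fun hle => ?_, A.le_lstar hl hM⟩
  refine le_trans ?_ (A.lstar_spec (hl.trans hle))
  have := A.gam_mono hl hle A.lstar_le_M
  gcongr

theorem lstar_congr (h1 : lam k = lam' k) (h2 : h k = h' k) :
    A.lstar mu lam h k = A.lstar mu lam' h' k := by
  simp only [lstar, h1, h2]

theorem quality_congr (h1 : lam k = lam' k) (h2 : h k = h' k) :
    A.quality mu lam h k = A.quality mu lam' h' k := by
  simp only [quality, A.lstar_congr (mu := mu) h1 h2, h1, h2]

theorem modeValue_succ (hl : l < A.M k) :
    mu k * A.p k (l + 1) / h k - lam k * A.rho k (l + 1) =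
      mu k * A.p k l / h k - lam k * A.rho k l +
        (mu k * A.gam k (l + 1) / h k - lam k) * (A.rho k (l + 1) - A.rho k l) := by
  rw [A.p_succ hl]; ring

/-- The quality of a user is the smallest Lagrangian cost of its modes. -/
theorem quality_le (hmu : 0 < mu k) (hh : 0 < h k) (hl : l ≤ A.M k) :
    A.quality mu lam h k ≤ mu k * A.p k l / h k - lam k * A.rho k l := by
  have hL := A.lstar_le_M (mu := mu) (lam := lam) (h := h) (k := k)
  have hd : ∀ n < A.M k, 0 < A.rho k (n + 1) - A.rho k n := fun n hn => sub_pos.2 (A.rho_lt k n hn)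
  rw [quality]
  generalize hLdef : A.lstar mu lam h k = L at *
  rcases le_total l L with hlL | hlL
  -- Below `L` every further mode has slope cost at most the weight, so the value does not increase
  -- towards `L`; in the other case it increases beyond `L`.
  · refine Nat.decreasingInduction'
      (P := fun l => mu k * A.p k L / h k - lam k * A.rho k L ≤
        mu k * A.p k l / h k - lam k * A.rho k l) (fun n hn _ ih => ih.trans ?_) hlL le_rfl
    rw [A.modeValue_succ (by omega)]
    have h1 := (A.le_lstar_iff (lam := lam) hmu hh (by omega : 1 ≤ n + 1) (by omega)).1
      (by omega)
    nlinarith [hd n (by omega)]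
  · induction l, hlL using Nat.le_induction with
    | base => exact le_rfl
    | succ n hn ih =>
      refine (ih (by omega)).trans ?_
      rw [A.modeValue_succ (by omega)]
      have h1 := (A.le_lstar_iff (lam := lam) hmu hh (by omega : 1 ≤ n + 1) (by omega)).not.1
        (by omega)
      nlinarith [hd n (by omega)]

theorem quality_nonpos (hmu : 0 < mu k) (hh : 0 < h k) : A.quality mu lam h k ≤ 0 := by
  simpa [A.p_zero, A.rho_zero] using A.quality_le (lam := lam) hmu hh (Nat.zero_le _)

theorem quality_eq_zero (hz : A.lstar mu lam h k = 0) : A.quality mu lam h k = 0 := by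
  simp [quality, hz, A.p_zero, A.rho_zero]

theorem lstar_eq_zero_iff (hmu : 0 < mu k) (hh : 0 < h k) :
    A.lstar mu lam h k = 0 ↔ lam k < mu k * A.gam k 1 / h k := by
  rw [← not_le, ← A.le_lstar_iff hmu hh le_rfl (A.one_le_M k)]; omega

/-- A user transmits at quality zero only for one value of its channel gain. -/
theorem lstar_eq_zero_of_quality (hmu : 0 < mu k) (hh : 0 < h k)
    (hq : A.quality mu lam h k = 0) (hne : mu k * A.gam k 1 / h k ≠ lam k) :
    A.lstar mu lam h k = 0 := by
  rw [A.lstar_eq_zero_iff hmu hh]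
  have h1 := A.quality_le (lam := lam) hmu hh (A.one_le_M k)
  -- Quality is at most the value `(μγ₁/h - λ)ρ₁` of mode 1, so quality zero puts the first
  -- threshold at or above the weight.
  rw [hq, A.modeValue_succ (l := 0) (A.one_le_M k)] at h1
  have hd := sub_pos.2 (A.rho_lt k 0 (A.one_le_M k))
  simp only [A.p_zero, A.rho_zero, mul_zero, zero_div, sub_zero, zero_add] at h1 hd
  by_contra hcon
  have := lt_of_le_of_ne (not_lt.1 hcon) hne
  nlinarith

theorem quality_neg (hmu : 0 < mu k) (hh : 0 < h k) (hlt : mu k * A.gam k 1 / h k < lam k) :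
    A.quality mu lam h k < 0 := by
  have h1 := A.quality_le (lam := lam) hmu hh (A.one_le_M k)
  rw [A.modeValue_succ (l := 0) (A.one_le_M k)] at h1
  have hd := sub_pos.2 (A.rho_lt k 0 (A.one_le_M k))
  simp only [A.p_zero, A.rho_zero, mul_zero, zero_div, sub_zero, zero_add] at h1 hd
  nlinarith

theorem lstar_mono (hle : lam k ≤ lam' k) :
    A.lstar mu lam h k ≤ A.lstar mu lam' h k := by
  rcases Nat.eq_zero_or_pos (A.lstar mu lam h k) with h0 | h0
  · omega
  · exact A.le_lstar h0 A.lstar_le_M ((A.lstar_spec h0).trans hle)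

/-- The mode chosen at the smaller weight is still available at the larger one and costs no more
there, rates being nonnegative. -/
theorem quality_anti (hmu : 0 < mu k) (hh : 0 < h k) (hle : lam k ≤ lam' k) :
    A.quality mu lam' h k ≤ A.quality mu lam h k := by
  refine (A.quality_le hmu hh (A.lstar_le_M (mu := mu) (lam := lam) (h := h))).trans ?_
  rw [quality]
  have := A.rho_nonneg (A.lstar_le_M (mu := mu) (lam := lam) (h := h) (k := k))
  gcongr

theorem neg_mul_rhoMax_le_quality (hmu : 0 < mu k) (hh : 0 < h k) (hlam : 0 ≤ lam k) :
    -(lam k * A.rhoMax k) ≤ A.quality mu lam h k := by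
  have h1 := A.rho_le_rhoMax (A.lstar_le_M (mu := mu) (lam := lam) (h := h) (k := k))
  have h2 := A.p_nonneg (A.lstar_le_M (mu := mu) (lam := lam) (h := h) (k := k))
  have h3 : 0 ≤ mu k * A.p k (A.lstar mu lam h k) / h k :=
    div_nonneg (mul_nonneg hmu.le h2) hh.le
  have h4 := mul_le_mul_of_nonneg_left h1 hlam
  rw [quality]; linarith

/-- Where a user transmits, its quality improves strictly with the channel gain. -/
theorem quality_strictAnti_gain (hmu : 0 < mu k) (hh : 0 < h k) (hlt : h k < h' k)
    (hq : A.quality mu lam h k < 0) : A.quality mu lam h' k < A.quality mu lam h k := by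
  have hL : 1 ≤ A.lstar mu lam h k := by
    by_contra h0
    exact hq.ne (A.quality_eq_zero (by omega))
  -- Keeping the old mode at the better gain is already strictly cheaper, since its power is
  -- positive.
  refine (A.quality_le hmu (hh.trans hlt)
    (A.lstar_le_M (mu := mu) (lam := lam) (h := h))).trans_lt ?_
  rw [quality]
  have := A.p_pos k _ hL A.lstar_le_M
  gcongr

/-! ### Measurability -/

theorem measurable_lstar (k : Fin K) : Measurable fun h => A.lstar mu lam h k := by
  unfold lstar
  generalize Finset.Icc 1 (A.M k) = s
  induction s using Finset.induction with
  | empty => simp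
  | insert a s ha ih =>
    have : (fun h : UserVec K =>
        ((insert a s).filter fun l => mu k * A.gam k l / h k ≤ lam k).sup id) =
        fun h => if mu k * A.gam k a / h k ≤ lam k
          then a ⊔ ((s.filter fun l => mu k * A.gam k l / h k ≤ lam k).sup id)
          else (s.filter fun l => mu k * A.gam k l / h k ≤ lam k).sup id := by
      funext h
      rw [Finset.filter_insert]
      split_ifs <;> simp
    rw [this]
    refine Measurable.ite ?_ ?_ ih
    · exact measurableSet_le (by fun_prop) measurable_const
    · exact (measurable_from_nat (f := fun n => a ⊔ n)).comp ih

theorem measurable_comp_lstar (f : ℕ → ℝ) (k : Fin K) :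
    Measurable fun h => f (A.lstar mu lam h k) :=
  (measurable_from_nat (f := f)).comp (A.measurable_lstar k)

theorem measurable_quality (k : Fin K) : Measurable fun h => A.quality mu lam h k := by
  unfold quality
  have h1 := A.measurable_comp_lstar (mu := mu) (lam := lam) (A.p k) k
  have h2 := A.measurable_comp_lstar (mu := mu) (lam := lam) (A.rho k) k
  exact ((h1.const_mul _).div (measurable_pi_apply k)).sub (h2.const_mul _)

theorem measurableSet_isBest (k : Fin K) : MeasurableSet {h | A.IsBest mu lam h k} := by
  simp only [IsBest, Set.ofPred_forall]
  exact MeasurableSet.iInter fun j =>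
    measurableSet_le (A.measurable_quality k) (A.measurable_quality j)

theorem measurable_greedyRate (k : Fin K) : Measurable fun h => A.greedyRate mu lam h k :=
  Measurable.ite (A.measurableSet_isBest k) (A.measurable_comp_lstar _ k) measurable_const

theorem greedyRate_nonneg : 0 ≤ A.greedyRate mu lam h k := by
  unfold greedyRate
  split_ifs
  exacts [A.rho_nonneg A.lstar_le_M, le_rfl]

theorem greedyRate_le : A.greedyRate mu lam h k ≤ A.rhoMax k := by
  unfold greedyRate
  split_ifs
  exacts [A.rho_le_rhoMax A.lstar_le_M, (A.rhoMax_pos k).le]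

theorem exists_isBest [NeZero K] (mu lam h : UserVec K) : ∃ k, A.IsBest mu lam h k := by
  obtain ⟨k, hk⟩ := Finite.exists_min (A.quality mu lam h)
  exact ⟨k, hk⟩

/-- Raising a user's own weight and lowering those of the others raises its greedy rate. -/
theorem greedyRate_le_greedyRate (hmu : ∀ k, 0 < mu k) (hh : ∀ k, 0 < h k)
    (hk : lam k ≤ lam' k) (hj : ∀ j ≠ k, lam' j ≤ lam j) :
    A.greedyRate mu lam h k ≤ A.greedyRate mu lam' h k := by
  by_cases hb : A.IsBest mu lam h k
  · have hb' : A.IsBest mu lam' h k := by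
      intro j
      by_cases hjk : j = k
      · rw [hjk]
      · exact (A.quality_anti (hmu k) (hh k) hk).trans
          ((hb j).trans (A.quality_anti (hmu j) (hh j) (hj j hjk)))
    simp only [greedyRate, hb, hb', if_true]
    exact A.rho_mono (A.lstar_mono hk) A.lstar_le_M
  · simp only [greedyRate, hb, if_false]
    exact A.greedyRate_nonneg

end AMCModes

/-! ### Null sets of fading states -/

/-- A measurable set that meets every line parallel to the `i`-th axis at most once is null. -/
theorem volume_eq_zero_of_translate {K : ℕ} {s : Set (UserVec K)} (hs : MeasurableSet s)
    (i : Fin K) (h : ∀ x ∈ s, ∀ y ∈ s, (∀ j ≠ i, x j = y j) → ¬ x i < y i) :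
    volume s = 0 := by
  -- Translates of `s` by these vectors are pairwise disjoint, as `s` has at most one point on each
  -- line. Infinitely many disjoint translates along a bounded sequence force measure zero.
  let u : ℕ → UserVec K := fun n => Pi.single i (1 / ((n : ℝ) + 1))
  have hinj : ∀ x ∈ s, ∀ y ∈ s, (∀ j ≠ i, x j = y j) → x i = y i := fun x hx y hy hxy =>
    le_antisymm (not_lt.1 (h y hy x hx fun j hj => (hxy j hj).symm)) (not_lt.1 (h x hx y hy hxy))
  refine Measure.addHaar_eq_zero_of_disjoint_translates volume u ?_ ?_ hs
  · refine (Metric.isBounded_closedBall (x := (0 : UserVec K)) (r := 1)).subset ?_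
    rintro _ ⟨n, rfl⟩
    rw [mem_closedBall_zero_iff, pi_norm_le_iff_of_nonneg zero_le_one]
    intro j
    have h0 : (0 : ℝ) < (n : ℝ) + 1 := by positivity
    by_cases hj : j = i
    · subst hj
      simp only [u, Pi.single_eq_same, Real.norm_eq_abs]
      rw [abs_of_pos (by positivity), div_le_one h0]
      linarith [(Nat.cast_nonneg n : (0 : ℝ) ≤ n)]
    · simp [u, hj]
  · intro m n hmn
    rw [Function.onFun, Set.disjoint_left]
    rintro z hz1 hz2
    simp only [Set.singleton_add, Set.mem_image] at hz1 hz2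
    obtain ⟨x, hx, rfl⟩ := hz1
    obtain ⟨y, hy, hxy⟩ := hz2
    have hcoord : ∀ j, u n j + y j = u m j + x j := fun j => congrFun hxy j
    have h1 := hinj x hx y hy fun j hj => by
      have := hcoord j
      simp only [u, Pi.single_eq_of_ne hj] at this
      linarith
    have h2 := hcoord i
    simp only [u, Pi.single_eq_same, h1] at h2
    have h3 : 1 / ((n : ℝ) + 1) = 1 / ((m : ℝ) + 1) := by linarith
    rw [one_div, one_div, inv_inj] at h3
    exact hmn (by exact_mod_cast (add_right_cancel h3).symm)

theorem ae_forall_pos {K : ℕ} {F : Measure (UserVec K)} (hF_nonneg : ∀ᵐ h ∂F, ∀ k, 0 ≤ h k)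
    (hF_cont : F ≪ volume) : ∀ᵐ h ∂F, ∀ k, 0 < h k := by
  have hne : ∀ᵐ h ∂F, ∀ k, h k ≠ 0 := by
    rw [ae_all_iff]
    intro k
    refine hF_cont.ae_le (measure_eq_zero_iff_ae_notMem.1 ?_)
    refine volume_eq_zero_of_translate (measurableSet_eq_fun (measurable_pi_apply k)
      measurable_const) k fun x hx y hy _ => ?_
    have hx : x k = 0 := hx
    have hy : y k = 0 := hy
    simp [hx, hy]
  filter_upwards [hF_nonneg, hne] with h h1 h2 k
  exact lt_of_le_of_ne (h1 k) (h2 k).symm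

namespace AMCModes

variable {K : ℕ} (A : AMCModes K) {mu lam lam' h h' : UserVec K} {k : Fin K} {l m : ℕ}
  {F : Measure (UserVec K)}

/-- A state is regular for given weights if the gains are positive, no mode threshold is met with
equality, and two users can tie only at quality zero. -/
structure IsRegular (mu lam h : UserVec K) : Prop where
  pos : ∀ k, 0 < h k
  threshold_ne : ∀ k, ∀ l, 1 ≤ l → l ≤ A.M k → mu k * A.gam k l / h k ≠ lam k
  quality_ne : ∀ i j, i ≠ j → A.quality mu lam h i < 0 → A.quality mu lam h i ≠ A.quality mu lam h j

/-- Each exceptional set meets a line parallel to a suitable axis at most once: a threshold is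
strictly decreasing in the user's own gain, and so is a negative quality, while the qualities of the
other users stay fixed. Ties at quality zero cannot be excluded, since silence persists on open sets
of states. -/
theorem ae_isRegular (hmu : ∀ k, 0 < mu k) (hF_nonneg : ∀ᵐ h ∂F, ∀ k, 0 ≤ h k)
    (hF_cont : F ≪ volume) (lam : UserVec K) : ∀ᵐ h ∂F, A.IsRegular mu lam h := by
  have hpos := ae_forall_pos hF_nonneg hF_cont
  have hm : MeasurableSet {h : UserVec K | ∀ k, 0 < h k} := by
    simp only [Set.ofPred_forall]
    exact MeasurableSet.iInter fun k => measurableSet_lt measurable_const (measurable_pi_apply k)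
  have h1 : ∀ᵐ h ∂F, ∀ k, ∀ l, 1 ≤ l → l ≤ A.M k → (∀ k, 0 < h k) →
      mu k * A.gam k l / h k ≠ lam k := by
    simp only [ae_all_iff]
    intro k l hl hM
    have : ∀ᵐ h ∂F, h ∉ {h : UserVec K | ∀ k, 0 < h k} ∩
        {h | mu k * A.gam k l / h k = lam k} := by
      refine hF_cont.ae_le (measure_eq_zero_iff_ae_notMem.1 ?_)
      refine volume_eq_zero_of_translate
        (hm.inter (measurableSet_eq_fun (by fun_prop) measurable_const)) k ?_
      rintro x ⟨hx, hx1⟩ y ⟨hy, hy1⟩ - hlt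
      have hx1 : mu k * A.gam k l / x k = lam k := hx1
      have hy1 : mu k * A.gam k l / y k = lam k := hy1
      have hc := mul_pos (hmu k) (A.gam_pos hl hM)
      have := div_lt_div_of_pos_left hc (hx k) hlt
      linarith
    filter_upwards [this] with h hh hp heq using hh ⟨hp, heq⟩
  have h2 : ∀ᵐ h ∂F, ∀ i j, i ≠ j → (∀ k, 0 < h k) → A.quality mu lam h i < 0 →
      A.quality mu lam h i ≠ A.quality mu lam h j := by
    simp only [ae_all_iff]
    intro i j hij
    have : ∀ᵐ h ∂F, h ∉ {h : UserVec K | ∀ k, 0 < h k} ∩ {h | A.quality mu lam h i < 0} ∩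
        {h | A.quality mu lam h i = A.quality mu lam h j} := by
      refine hF_cont.ae_le (measure_eq_zero_iff_ae_notMem.1 ?_)
      refine volume_eq_zero_of_translate
        ((hm.inter (measurableSet_lt (A.measurable_quality i) measurable_const)).inter
          (measurableSet_eq_fun (A.measurable_quality i) (A.measurable_quality j))) i ?_
      rintro x ⟨⟨hx, hx1⟩, hx2⟩ y ⟨⟨hy, hy1⟩, hy2⟩ hxy hlt
      have hx2 : A.quality mu lam x i = A.quality mu lam x j := hx2
      have hy2 : A.quality mu lam y i = A.quality mu lam y j := hy2
      have h1 := A.quality_strictAnti_gain (hmu i) (hx i) hlt hx1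
      rw [hx2, hy2, A.quality_congr (lam := lam) rfl (hxy j hij.symm)] at h1
      exact h1.false
    filter_upwards [this] with h hh hp hq heq using hh ⟨⟨hp, hq⟩, heq⟩
  filter_upwards [hpos, h1, h2] with h hp h1 h2
  exact ⟨hp, fun k l hl hM => h1 k l hl hM hp, fun i j hij => h2 i j hij hp⟩

/-! ### Greedy policies and their rates -/

/-- The average greedy rate of user `k`, as a function of the weights. -/
noncomputable def meanRate (F : Measure (UserVec K)) (mu lam : UserVec K) (k : Fin K) : ℝ :=
  ∫ h, A.greedyRate mu lam h k ∂F

variable {A}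

theorem IsGreedy.sum_mul {t : UserVec K → Fin K → ℕ → ℝ} (ht : A.IsGreedy mu lam t)
    (hh : ∀ k, 0 < h k) (k : Fin K) (a : ℕ → ℝ) :
    ∑ l ∈ Finset.range (A.M k + 1), t h k l * a l =
      t h k (A.lstar mu lam h k) * a (A.lstar mu lam h k) := by
  refine Finset.sum_eq_single_of_mem _
    (Finset.mem_range.2 (Nat.lt_succ_of_le A.lstar_le_M)) fun l hl hne => ?_
  rw [ht.2 h hh k l (Nat.lt_succ_iff.1 (Finset.mem_range.1 hl)) fun hb => hne hb.2, zero_mul]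

theorem IsGreedy.userTime_eq {t : UserVec K → Fin K → ℕ → ℝ} (ht : A.IsGreedy mu lam t)
    (hh : ∀ k, 0 < h k) (k : Fin K) : A.userTime t h k = t h k (A.lstar mu lam h k) := by
  simpa [userTime] using ht.sum_mul hh k fun _ => 1

theorem IsGreedy.time_eq_zero {t : UserVec K → Fin K → ℕ → ℝ} (ht : A.IsGreedy mu lam t)
    (hh : ∀ k, 0 < h k) {k : Fin K} (hb : ¬ A.IsBest mu lam h k) :
    t h k (A.lstar mu lam h k) = 0 :=
  ht.2 h hh k _ A.lstar_le_M fun hb' => hb hb'.1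

theorem IsModePolicy.sum_userTime {t : UserVec K → Fin K → ℕ → ℝ} (ht : A.IsModePolicy t)
    (hh : ∀ k, 0 < h k) : ∑ k, A.userTime t h k = 1 := ht.sum_eq_one h hh

theorem IsModePolicy.userTime_nonneg {t : UserVec K → Fin K → ℕ → ℝ} (ht : A.IsModePolicy t)
    (hh : ∀ k, 0 < h k) (k : Fin K) : 0 ≤ A.userTime t h k :=
  Finset.sum_nonneg fun l hl =>
    ht.nonneg h hh k l (Nat.lt_succ_iff.1 (Finset.mem_range.1 hl))

/-- Without users the empty sum of time fractions would have to equal one. -/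
theorem IsModePolicy.ne_zero {t : UserVec K → Fin K → ℕ → ℝ} (ht : A.IsModePolicy t) :
    NeZero K := by
  refine ⟨?_⟩
  rintro rfl
  simpa using ht.sum_eq_one 0 fun k => k.elim0

/-- In a regular state all greedy policies give the same rates. -/
theorem IsGreedy.rate_eq {t : UserVec K → Fin K → ℕ → ℝ} (ht : A.IsGreedy mu lam t)
    (hmu : ∀ k, 0 < mu k) (hreg : A.IsRegular mu lam h) (k : Fin K) :
    ∑ l ∈ Finset.range (A.M k + 1), t h k l * A.rho k l = A.greedyRate mu lam h k := by
  rw [ht.sum_mul hreg.pos]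
  by_cases hb : A.IsBest mu lam h k
  · rw [greedyRate, if_pos hb]
    -- At quality zero the chosen mode is silent, so the time share is irrelevant; at negative
    -- quality the best user is unique and gets the whole block.
    rcases (A.quality_nonpos (lam := lam) (hmu k) (hreg.pos k)).eq_or_lt with h0 | hneg
    · rw [A.lstar_eq_zero_of_quality (hmu k) (hreg.pos k) h0
        (hreg.threshold_ne k 1 le_rfl (A.one_le_M k)), A.rho_zero, mul_zero]
    · have hone : t h k (A.lstar mu lam h k) = 1 := by
        rw [← ht.userTime_eq hreg.pos k, ← ht.1.sum_userTime hreg.pos]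
        refine (Finset.sum_eq_single_of_mem k (Finset.mem_univ k) fun j _ hj => ?_).symm
        rw [ht.userTime_eq hreg.pos j]
        refine ht.time_eq_zero hreg.pos fun hbj => ?_
        exact hreg.quality_ne k j hj.symm hneg (le_antisymm (hb j) (hbj k))
      rw [hone, one_mul]
  · rw [ht.time_eq_zero hreg.pos hb, greedyRate, if_neg hb, zero_mul]

variable (A)

/-- Tie-breaking affects rates only on a null set, so the weights alone determine the average rates.
-/
theorem avgRate_eq_meanRate (hmu : ∀ k, 0 < mu k) (hF_nonneg : ∀ᵐ h ∂F, ∀ k, 0 ≤ h k)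
    (hF_cont : F ≪ volume) {t : UserVec K → Fin K → ℕ → ℝ} (ht : A.IsGreedy mu lam t)
    (k : Fin K) : A.avgRate F t k = A.meanRate F mu lam k := by
  refine integral_congr_ae ?_
  filter_upwards [A.ae_isRegular hmu hF_nonneg hF_cont lam] with h hreg
  exact ht.rate_eq hmu hreg k

open Classical in
/-- The greedy policy that gives all the time to the first best user. -/
noncomputable def greedyPolicy (mu lam h : UserVec K) (k : Fin K) (l : ℕ) : ℝ :=
  if (A.IsBest mu lam h k ∧ ∀ j < k, ¬ A.IsBest mu lam h j) ∧ l = A.lstar mu lam h k then 1 else 0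

theorem isGreedy_greedyPolicy [NeZero K] (mu lam : UserVec K) :
    A.IsGreedy mu lam (A.greedyPolicy mu lam) := by
  classical
  refine ⟨⟨fun k l => ?_, fun h _ k l _ => ?_, fun h _ => ?_⟩, fun h _ k l _ hne => ?_⟩
  · refine Measurable.ite ?_ measurable_const measurable_const
    have h1 : MeasurableSet {h | ∀ j < k, ¬ A.IsBest mu lam h j} := by
      simp only [Set.ofPred_forall]
      exact MeasurableSet.iInter fun j => MeasurableSet.iInter fun _ =>
        (A.measurableSet_isBest j).compl
    have h2 : MeasurableSet {h | l = A.lstar mu lam h k} :=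
      measurableSet_eq_fun measurable_const (A.measurable_lstar k)
    exact ((A.measurableSet_isBest k).inter h1).inter h2
  · unfold greedyPolicy
    split_ifs <;> norm_num
  · let s : Finset (Fin K) := Finset.univ.filter fun k => A.IsBest mu lam h k
    have hs : s.Nonempty := by
      obtain ⟨k, hk⟩ := A.exists_isBest mu lam h
      exact ⟨k, by simpa [s] using hk⟩
    have hmin : A.IsBest mu lam h (s.min' hs) := by simpa [s] using s.min'_mem hs
    have hfirst : ∀ k, (A.IsBest mu lam h k ∧ ∀ j < k, ¬ A.IsBest mu lam h j) ↔ k = s.min' hs := by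
      intro k
      constructor
      · rintro ⟨hk, hlt⟩
        refine le_antisymm (not_lt.1 fun hcon => hlt _ hcon hmin) ?_
        exact s.min'_le k (by simpa [s] using hk)
      · rintro rfl
        exact ⟨hmin, fun j hj hb => (s.min'_le j (by simpa [s] using hb)).not_gt hj⟩
    simp only [greedyPolicy, hfirst]
    rw [Finset.sum_eq_single_of_mem (s.min' hs) (Finset.mem_univ _)]
    · rw [Finset.sum_eq_single_of_mem (A.lstar mu lam h (s.min' hs))
        (Finset.mem_range.2 (Nat.lt_succ_of_le A.lstar_le_M))]
      · simp
      · intro l _ hl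
        simp [hl]
    · intro k _ hk
      simp [hk]
  · unfold greedyPolicy
    rw [if_neg fun hb => hne ⟨hb.1.1, hb.2⟩]

theorem isMultiplier_iff [NeZero K] (hmu : ∀ k, 0 < mu k) (hF_nonneg : ∀ᵐ h ∂F, ∀ k, 0 ≤ h k)
    (hF_cont : F ≪ volume) {R : UserVec K} :
    A.IsMultiplier F mu R lam ↔ (∀ k, 0 < lam k) ∧ ∀ k, A.meanRate F mu lam k = R k := by
  refine and_congr_right fun _ => ⟨?_, fun hr => ?_⟩
  · rintro ⟨t, ht, hr⟩ k
    rw [← hr, A.avgRate_eq_meanRate hmu hF_nonneg hF_cont ht]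
  · refine ⟨_, A.isGreedy_greedyPolicy mu lam, fun k => ?_⟩
    rw [A.avgRate_eq_meanRate hmu hF_nonneg hF_cont (A.isGreedy_greedyPolicy mu lam), hr]

theorem isStep_iff [NeZero K] (hmu : ∀ k, 0 < mu k) (hF_nonneg : ∀ᵐ h ∂F, ∀ k, 0 ≤ h k)
    (hF_cont : F ≪ volume) {R : UserVec K} {x : ℝ} :
    A.IsStep F mu R lam k x ↔
      0 < x ∧ A.meanRate F mu (Function.update lam k x) k = R k := by
  refine and_congr_right fun _ => ⟨?_, fun hr => ?_⟩
  · rintro ⟨t, ht, hr⟩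
    rw [← hr, A.avgRate_eq_meanRate hmu hF_nonneg hF_cont ht]
  · refine ⟨_, A.isGreedy_greedyPolicy mu _, ?_⟩
    rw [A.avgRate_eq_meanRate hmu hF_nonneg hF_cont (A.isGreedy_greedyPolicy mu _), hr]

end AMCModes

/-! ### Lagrangian duality -/

namespace AMCModes

variable {K : ℕ} (A : AMCModes K) {mu lam lam' h h' : UserVec K} {k : Fin K} {l m : ℕ}
  {F : Measure (UserVec K)} {R : UserVec K} {t : UserVec K → Fin K → ℕ → ℝ}

/-- The largest Lagrangian gain in state `h`, `max_k (-φ_k(h))`. -/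
noncomputable def gain (mu lam h : UserVec K) : ℝ := ⨆ k, -A.quality mu lam h k

theorem neg_quality_le_gain (mu lam h : UserVec K) (k : Fin K) :
    -A.quality mu lam h k ≤ A.gain mu lam h :=
  le_ciSup (f := fun k => -A.quality mu lam h k) (Set.finite_range _).bddAbove k

theorem gain_eq_of_isBest (hb : A.IsBest mu lam h k) :
    A.gain mu lam h = -A.quality mu lam h k := by
  have : Nonempty (Fin K) := ⟨k⟩
  exact le_antisymm (ciSup_le fun j => neg_le_neg (hb j)) (A.neg_quality_le_gain mu lam h k)

theorem gain_nonneg (hmu : ∀ k, 0 < mu k) (hh : ∀ k, 0 < h k) : 0 ≤ A.gain mu lam h :=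
  -- This form needs no users: the empty real supremum is 0.
  Real.iSup_nonneg fun k => neg_nonneg.2 (A.quality_nonpos (hmu k) (hh k))

theorem gain_le (hmu : ∀ k, 0 < mu k) (hlam : ∀ k, 0 < lam k) (hh : ∀ k, 0 < h k) :
    A.gain mu lam h ≤ ∑ k, lam k * A.rhoMax k := by
  have h0 : ∀ k ∈ Finset.univ, 0 ≤ lam k * A.rhoMax k := fun k _ =>
    mul_nonneg (hlam k).le (A.rhoMax_pos k).le
  refine Real.iSup_le (fun k => ?_) (Finset.sum_nonneg h0)
  have h1 := A.neg_mul_rhoMax_le_quality (hmu k) (hh k) (hlam k).le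
  have h2 := Finset.single_le_sum h0 (Finset.mem_univ k)
  linarith

theorem measurable_gain : Measurable fun h => A.gain mu lam h :=
  Measurable.iSup fun k => (A.measurable_quality k).neg

theorem mode_le_gain (hmu : 0 < mu k) (hh : 0 < h k) (hl : l ≤ A.M k) :
    lam k * A.rho k l ≤ mu k * A.p k l / h k + A.gain mu lam h := by
  have h1 := A.quality_le (lam := lam) hmu hh hl
  have h2 := A.neg_quality_le_gain mu lam h k
  linarith

/-- Weak duality in one state. -/
theorem sum_rate_le (hmu : ∀ k, 0 < mu k) (hh : ∀ k, 0 < h k) (ht : A.IsModePolicy t) :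
    ∑ k, lam k * ∑ l ∈ Finset.range (A.M k + 1), t h k l * A.rho k l ≤
      (∑ k, ∑ l ∈ Finset.range (A.M k + 1), mu k * (t h k l / h k) * A.p k l) +
        A.gain mu lam h := by
  -- The time fractions sum to one, so the gain can be spread over the modes and the claim checked
  -- mode by mode.
  have h1 : A.gain mu lam h =
      ∑ k, ∑ l ∈ Finset.range (A.M k + 1), t h k l * A.gain mu lam h := by
    simp only [← Finset.sum_mul]
    rw [ht.sum_eq_one h hh, one_mul]
  rw [h1, ← Finset.sum_add_distrib]
  refine Finset.sum_le_sum fun k _ => ?_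
  rw [Finset.mul_sum, ← Finset.sum_add_distrib]
  refine Finset.sum_le_sum fun l hl => ?_
  have hl := Nat.lt_succ_iff.1 (Finset.mem_range.1 hl)
  have h2 := mul_le_mul_of_nonneg_left (A.mode_le_gain (lam := lam) (hmu k) (hh k) hl)
    (ht.nonneg h hh k l hl)
  calc lam k * (t h k l * A.rho k l) = t h k l * (lam k * A.rho k l) := by ring
    _ ≤ _ := h2
    _ = _ := by ring

/-- Strong duality in one state, for greedy policies. -/
theorem sum_rate_eq (hh : ∀ k, 0 < h k) (ht : A.IsGreedy mu lam t) :
    ∑ k, lam k * ∑ l ∈ Finset.range (A.M k + 1), t h k l * A.rho k l =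
      (∑ k, ∑ l ∈ Finset.range (A.M k + 1), mu k * (t h k l / h k) * A.p k l) +
        A.gain mu lam h := by
  have h1 : A.gain mu lam h = ∑ k, A.userTime t h k * A.gain mu lam h := by
    rw [← Finset.sum_mul, ht.1.sum_userTime hh, one_mul]
  rw [h1, ← Finset.sum_add_distrib]
  refine Finset.sum_congr rfl fun k _ => ?_
  have h2 : ∀ l, mu k * (t h k l / h k) * A.p k l = t h k l * (mu k * A.p k l / h k) :=
    fun l => by ring
  simp only [h2]
  rw [ht.sum_mul hh, ht.sum_mul hh k fun l => mu k * A.p k l / h k, ht.userTime_eq hh]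
  by_cases hb : A.IsBest mu lam h k
  · rw [A.gain_eq_of_isBest hb, quality]; ring
  · rw [ht.time_eq_zero hh hb]; simp

/-- The greedy rates are a subgradient of the gain as a function of the weights. -/
theorem sum_greedyRate_le_gain_sub [NeZero K] (hmu : ∀ k, 0 < mu k)
    (hreg : A.IsRegular mu lam h) (lam' : UserVec K) :
    ∑ k, (lam' k - lam k) * A.greedyRate mu lam h k ≤ A.gain mu lam' h - A.gain mu lam h := by
  have ht := A.isGreedy_greedyPolicy mu lam
  -- The same policy satisfies the inequality for `lam'` and the equality for `lam`; subtracting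
  -- cancels its power.
  have h1 := A.sum_rate_le (lam := lam') hmu hreg.pos ht.1
  have h2 := A.sum_rate_eq hreg.pos ht
  simp only [ht.rate_eq hmu hreg] at h1 h2
  simp only [sub_mul, Finset.sum_sub_distrib]
  linarith

theorem integrable_greedyRate [IsProbabilityMeasure F] :
    Integrable (fun h => A.greedyRate mu lam h k) F := by
  refine Integrable.of_bound (A.measurable_greedyRate k).aestronglyMeasurable (A.rhoMax k) ?_
  refine Eventually.of_forall fun h => ?_
  rw [Real.norm_of_nonneg A.greedyRate_nonneg]
  exact A.greedyRate_le

theorem integrable_gain [IsProbabilityMeasure F] (hmu : ∀ k, 0 < mu k) (hlam : ∀ k, 0 < lam k)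
    (hpos : ∀ᵐ h ∂F, ∀ k, 0 < h k) : Integrable (fun h => A.gain mu lam h) F := by
  refine Integrable.of_bound A.measurable_gain.aestronglyMeasurable
    (∑ k, lam k * A.rhoMax k) ?_
  filter_upwards [hpos] with h hh
  rw [Real.norm_of_nonneg (A.gain_nonneg hmu hh)]
  exact A.gain_le hmu hlam hh

/-- The average gain, as a function of the weights. -/
noncomputable def meanGain (F : Measure (UserVec K)) (mu lam : UserVec K) : ℝ :=
  ∫ h, A.gain mu lam h ∂F

theorem integral_sum_greedyRate [IsProbabilityMeasure F] (a : UserVec K) :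
    ∫ h, ∑ k, a k * A.greedyRate mu lam h k ∂F = ∑ k, a k * A.meanRate F mu lam k := by
  rw [integral_finsetSum _ fun k _ => A.integrable_greedyRate.const_mul _]
  simp only [integral_const_mul, meanRate]

theorem sum_meanRate_le_meanGain_sub [NeZero K] [IsProbabilityMeasure F] (hmu : ∀ k, 0 < mu k)
    (hF_nonneg : ∀ᵐ h ∂F, ∀ k, 0 ≤ h k) (hF_cont : F ≪ volume) (hlam : ∀ k, 0 < lam k)
    (hlam' : ∀ k, 0 < lam' k) :
    ∑ k, (lam' k - lam k) * A.meanRate F mu lam k ≤ A.meanGain F mu lam' - A.meanGain F mu lam := by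
  have hpos := ae_forall_pos hF_nonneg hF_cont
  have h1 := A.integrable_gain hmu hlam hpos
  have h2 := A.integrable_gain hmu hlam' hpos
  rw [meanGain, meanGain, ← integral_sub h2 h1,
    ← A.integral_sum_greedyRate fun k => lam' k - lam k]
  refine integral_mono_ae (integrable_finsetSum _ fun k _ =>
    A.integrable_greedyRate.const_mul _) (h2.sub h1) ?_
  filter_upwards [A.ae_isRegular hmu hF_nonneg hF_cont lam] with h hreg
  exact A.sum_greedyRate_le_gain_sub hmu hreg lam'

/-! ### Optimality of greedy policies -/

theorem sum_le_lintegral_add_gain {c : UserVec K → ℝ≥0∞} {y : UserVec K → Fin K → ℝ≥0∞}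
    (hy : ∀ k, AEMeasurable (fun h => y h k) F)
    (hle : ∀ᵐ h ∂F, ∑ k, ENNReal.ofReal (lam k) * y h k ≤ c h + ENNReal.ofReal (A.gain mu lam h))
    (hR : ∀ k, ENNReal.ofReal (R k) ≤ ∫⁻ h, y h k ∂F) :
    ∑ k, ENNReal.ofReal (lam k) * ENNReal.ofReal (R k) ≤
      ∫⁻ h, c h ∂F + ∫⁻ h, ENNReal.ofReal (A.gain mu lam h) ∂F := by
  rw [← lintegral_add_right _ A.measurable_gain.ennreal_ofReal]
  refine le_trans ?_ (lintegral_mono_ae hle)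
  rw [lintegral_finsetSum' _ fun k _ => (hy k).const_mul _]
  refine Finset.sum_le_sum fun k _ => ?_
  rw [lintegral_const_mul'' _ (hy k)]
  gcongr
  exact hR k

/-- The power of an allocation over modes, in one state. -/
noncomputable def statePower (mu : UserVec K) (t : UserVec K → Fin K → ℕ → ℝ) (h : UserVec K)
    (k : Fin K) : ℝ :=
  ∑ l ∈ Finset.range (A.M k + 1), mu k * (t h k l / h k) * A.p k l

/-- The rate of an allocation over modes, in one state. -/
noncomputable def stateRate (t : UserVec K → Fin K → ℕ → ℝ) (h : UserVec K) (k : Fin K) : ℝ :=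
  ∑ l ∈ Finset.range (A.M k + 1), t h k l * A.rho k l

theorem statePower_nonneg (hmu : ∀ k, 0 < mu k) (hh : ∀ k, 0 < h k) (ht : A.IsModePolicy t) :
    0 ≤ A.statePower mu t h k := by
  refine Finset.sum_nonneg fun l hl => ?_
  have hl := Nat.lt_succ_iff.1 (Finset.mem_range.1 hl)
  exact mul_nonneg (mul_nonneg (hmu k).le (div_nonneg (ht.nonneg h hh k l hl) (hh k).le))
    (A.p_nonneg hl)

theorem stateRate_nonneg (hh : ∀ k, 0 < h k) (ht : A.IsModePolicy t) :
    0 ≤ A.stateRate t h k := by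
  refine Finset.sum_nonneg fun l hl => ?_
  have hl := Nat.lt_succ_iff.1 (Finset.mem_range.1 hl)
  exact mul_nonneg (ht.nonneg h hh k l hl) (A.rho_nonneg hl)

theorem stateRate_le (hh : ∀ k, 0 < h k) (ht : A.IsModePolicy t) :
    A.stateRate t h k ≤ A.userTime t h k * A.rhoMax k := by
  rw [userTime, Finset.sum_mul]
  refine Finset.sum_le_sum fun l hl => ?_
  have hl := Nat.lt_succ_iff.1 (Finset.mem_range.1 hl)
  exact mul_le_mul_of_nonneg_left (A.rho_le_rhoMax hl) (ht.nonneg h hh k l hl)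

theorem userTime_le_one (hh : ∀ k, 0 < h k) (ht : A.IsModePolicy t) : A.userTime t h k ≤ 1 := by
  rw [← ht.sum_userTime hh]
  exact Finset.single_le_sum (fun k _ => ht.userTime_nonneg hh k) (Finset.mem_univ k)

theorem measurable_stateRate (ht : A.IsModePolicy t) : Measurable fun h => A.stateRate t h k :=
  Finset.measurable_fun_sum _ fun l _ => (ht.measurable k l).mul_const _

theorem measurable_statePower (ht : A.IsModePolicy t) :
    Measurable fun h => A.statePower mu t h k :=
  Finset.measurable_fun_sum _ fun l _ =>
    (((ht.measurable k l).div (measurable_pi_apply k)).const_mul _).mul_const _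

theorem measurable_userTime (ht : A.IsModePolicy t) : Measurable (A.userTime t) :=
  measurable_pi_lambda _ fun k => Finset.measurable_fun_sum _ fun l _ => ht.measurable k l

theorem integrable_stateRate [IsProbabilityMeasure F] (hpos : ∀ᵐ h ∂F, ∀ k, 0 < h k)
    (ht : A.IsModePolicy t) : Integrable (fun h => A.stateRate t h k) F := by
  refine Integrable.of_bound (A.measurable_stateRate ht).aestronglyMeasurable (A.rhoMax k) ?_
  filter_upwards [hpos] with h hh
  rw [Real.norm_of_nonneg (A.stateRate_nonneg hh ht)]
  have h1 := A.stateRate_le (k := k) hh ht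
  have h2 := mul_le_mul_of_nonneg_right (A.userTime_le_one (k := k) hh ht) (A.rhoMax_pos k).le
  linarith

theorem ofReal_avgRate [IsProbabilityMeasure F] (hpos : ∀ᵐ h ∂F, ∀ k, 0 < h k)
    (ht : A.IsModePolicy t) :
    ENNReal.ofReal (A.avgRate F t k) = ∫⁻ h, ENNReal.ofReal (A.stateRate t h k) ∂F := by
  refine ofReal_integral_eq_lintegral_ofReal (A.integrable_stateRate hpos ht) ?_
  filter_upwards [hpos] with h hh using A.stateRate_nonneg hh ht

theorem modeCost_eq_lintegral (ht : A.IsModePolicy t) :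
    A.modeCost F mu t = ∫⁻ h, ∑ k, ENNReal.ofReal (A.statePower mu t h k) ∂F := by
  rw [lintegral_finsetSum _ fun k _ => (A.measurable_statePower ht).ennreal_ofReal]
  rfl

theorem sum_le_modeCost_add_gain [IsProbabilityMeasure F] (hmu : ∀ k, 0 < mu k)
    (hlam : ∀ k, 0 < lam k) (hpos : ∀ᵐ h ∂F, ∀ k, 0 < h k) (ht : A.IsFeasibleModes F R t) :
    ∑ k, ENNReal.ofReal (lam k) * ENNReal.ofReal (R k) ≤
      A.modeCost F mu t + ∫⁻ h, ENNReal.ofReal (A.gain mu lam h) ∂F := by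
  rw [A.modeCost_eq_lintegral ht.1]
  refine A.sum_le_lintegral_add_gain (y := fun h k => ENNReal.ofReal (A.stateRate t h k))
    (fun k => (A.measurable_stateRate ht.1).ennreal_ofReal.aemeasurable) ?_ fun k => ?_
  · filter_upwards [hpos] with h hh
    have h0 := fun k => A.stateRate_nonneg (k := k) hh ht.1
    have h1 := fun k => A.statePower_nonneg (k := k) hmu hh ht.1
    simp only [← ENNReal.ofReal_mul (hlam _).le]
    rw [← ENNReal.ofReal_sum_of_nonneg fun k _ => mul_nonneg (hlam k).le (h0 k),
      ← ENNReal.ofReal_sum_of_nonneg fun k _ => h1 k,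
      ← ENNReal.ofReal_add (Finset.sum_nonneg fun k _ => h1 k) (A.gain_nonneg hmu hh)]
    exact ENNReal.ofReal_le_ofReal (A.sum_rate_le hmu hh ht.1)
  · rw [← A.ofReal_avgRate hpos ht.1]
    exact ENNReal.ofReal_le_ofReal (ht.2 k)

theorem modeCost_add_gain [IsProbabilityMeasure F] (hmu : ∀ k, 0 < mu k)
    (hlam : ∀ k, 0 < lam k) (hpos : ∀ᵐ h ∂F, ∀ k, 0 < h k) (ht : A.IsGreedy mu lam t) :
    A.modeCost F mu t + ∫⁻ h, ENNReal.ofReal (A.gain mu lam h) ∂F =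
      ∑ k, ENNReal.ofReal (lam k) * ENNReal.ofReal (A.avgRate F t k) := by
  rw [A.modeCost_eq_lintegral ht.1, ← lintegral_add_right _ A.measurable_gain.ennreal_ofReal]
  simp only [A.ofReal_avgRate hpos ht.1]
  simp only [← lintegral_const_mul _ (A.measurable_stateRate ht.1).ennreal_ofReal]
  rw [← lintegral_finsetSum _ fun k _ =>
    (A.measurable_stateRate ht.1).ennreal_ofReal.const_mul _]
  refine lintegral_congr_ae ?_
  filter_upwards [hpos] with h hh
  have h0 := fun k => A.stateRate_nonneg (k := k) hh ht.1
  have h1 := fun k => A.statePower_nonneg (k := k) hmu hh ht.1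
  simp only [← ENNReal.ofReal_mul (hlam _).le]
  rw [← ENNReal.ofReal_sum_of_nonneg fun k _ => mul_nonneg (hlam k).le (h0 k),
    ← ENNReal.ofReal_sum_of_nonneg fun k _ => h1 k,
    ← ENNReal.ofReal_add (Finset.sum_nonneg fun k _ => h1 k) (A.gain_nonneg hmu hh)]
  exact congrArg _ (A.sum_rate_eq hh ht).symm

theorem lintegral_gain_ne_top [IsProbabilityMeasure F] (hmu : ∀ k, 0 < mu k)
    (hlam : ∀ k, 0 < lam k) (hpos : ∀ᵐ h ∂F, ∀ k, 0 < h k) :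
    ∫⁻ h, ENNReal.ofReal (A.gain mu lam h) ∂F ≠ ⊤ := by
  rw [← ofReal_integral_eq_lintegral_ofReal (A.integrable_gain hmu hlam hpos)
    (by filter_upwards [hpos] with h hh using A.gain_nonneg hmu hh)]
  exact ENNReal.ofReal_ne_top

/-- Greedy policies attain the dual bound with equality; the integral of the gain is finite and
cancels. -/
theorem isOptimalModes_of_isGreedy [IsProbabilityMeasure F] (hmu : ∀ k, 0 < mu k)
    (hlam : ∀ k, 0 < lam k) (hpos : ∀ᵐ h ∂F, ∀ k, 0 < h k) (ht : A.IsGreedy mu lam t)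
    (hR : ∀ k, A.avgRate F t k = R k) : A.IsOptimalModes F mu R t := by
  have h1 := A.modeCost_add_gain hmu hlam hpos ht
  simp only [hR] at h1
  have hfin : A.modeCost F mu t ≠ ⊤ := by
    refine ne_top_of_le_ne_top ?_ (le_self_add.trans h1.le)
    exact (ENNReal.sum_lt_top.2 fun k _ =>
      ENNReal.mul_lt_top ENNReal.ofReal_lt_top ENNReal.ofReal_lt_top).ne
  refine ⟨⟨ht.1, fun k => (hR k).ge⟩, hfin, fun t' ht' => ?_⟩
  have h2 := A.sum_le_modeCost_add_gain hmu hlam hpos ht'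
  rw [← h1] at h2
  exact (ENNReal.add_le_add_iff_right (A.lintegral_gain_ne_top hmu hlam hpos)).1 h2

/-! ### The rate and time allocation problem -/

theorem upsilon_rho (hl : l ≤ A.M k) (g : ℝ) :
    A.upsilon k g (A.rho k l) = ENNReal.ofReal (A.p k l / g) := by
  have hM : A.rho k l ≤ A.rho k (A.M k) := A.rho_le_rhoMax hl
  simp only [upsilon, hM, if_true]
  rcases Nat.eq_zero_or_pos l with rfl | h0
  -- Rate 0 is the left endpoint of segment 1, whereas every other breakpoint is evaluated as the
  -- right endpoint of its own segment.
  · have : sInf {m : ℕ | 1 ≤ m ∧ A.rho k 0 ≤ A.rho k m} = 1 := by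
      refine le_antisymm (Nat.sInf_le ⟨le_rfl, A.rho_mono zero_le_one (A.one_le_M k)⟩) ?_
      exact (Nat.sInf_mem (s := {m : ℕ | 1 ≤ m ∧ A.rho k 0 ≤ A.rho k m})
        ⟨1, le_rfl, A.rho_mono zero_le_one (A.one_le_M k)⟩).1
    rw [this]
    simp
  · have : sInf {m : ℕ | 1 ≤ m ∧ A.rho k l ≤ A.rho k m} = l := by
      refine le_antisymm (Nat.sInf_le ⟨h0, le_rfl⟩) ?_
      have hmem := Nat.sInf_mem (s := {m : ℕ | 1 ≤ m ∧ A.rho k l ≤ A.rho k m}) ⟨l, h0, le_rfl⟩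
      by_contra hcon
      exact (A.rho_strictMono (not_le.1 hcon) hl).not_ge hmem.2
    rw [this]
    have h2 := A.p_succ (k := k) (l := l - 1) (by omega)
    rw [Nat.sub_add_cancel h0] at h2
    rw [← add_div, ← h2]

/-- Weak duality for one user in one state, at arbitrary rates. -/
theorem mul_rate_le (hmu : ∀ k, 0 < mu k) (hlam : ∀ k, 0 < lam k) (hh : ∀ k, 0 < h k)
    {τ r : ℝ} (hτ : 0 ≤ τ) (hr : 0 ≤ r) :
    ENNReal.ofReal (lam k) * ENNReal.ofReal (τ * r) ≤
      ENNReal.ofReal (mu k * τ) * A.upsilon k (h k) r +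
        ENNReal.ofReal (τ * A.gain mu lam h) := by
  -- Zero time is split off because `0 * ⊤ = 0` would spoil the infinite-power case at the end.
  rcases hτ.eq_or_lt with rfl | hτ
  · simp
  by_cases hM : r ≤ A.rho k (A.M k)
  · set l := sInf {m : ℕ | 1 ≤ m ∧ r ≤ A.rho k m} with hl
    have hmem : l ∈ {m : ℕ | 1 ≤ m ∧ r ≤ A.rho k m} := Nat.sInf_mem ⟨_, A.one_le_M k, hM⟩
    have hlM : l ≤ A.M k := Nat.sInf_le ⟨A.one_le_M k, hM⟩
    have hl1 : 1 ≤ l := hmem.1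
    have hrl : r ≤ A.rho k l := hmem.2
    have hlr : A.rho k (l - 1) ≤ r := by
      rcases hl1.eq_or_lt with h1 | h1
      · rw [← h1, Nat.sub_self, A.rho_zero]; exact hr
      · by_contra hcon
        have := Nat.sInf_le (s := {m : ℕ | 1 ≤ m ∧ r ≤ A.rho k m}) (m := l - 1)
          ⟨by omega, (not_le.1 hcon).le⟩
        omega
    have hu : A.upsilon k (h k) r = ENNReal.ofReal
        (A.p k (l - 1) / h k + A.gam k l * (r - A.rho k (l - 1)) / h k) := by
      simp only [upsilon, hM, if_true, ← hl]
    have hΥ : 0 ≤ A.p k (l - 1) / h k + A.gam k l * (r - A.rho k (l - 1)) / h k := by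
      have h1 := A.p_nonneg (k := k) (l := l - 1) (by omega)
      have h2 := A.gam_pos hl1 hlM
      have h3 := sub_nonneg.2 hlr
      have h4 := hh k
      positivity
    have hg := A.gain_nonneg (lam := lam) hmu hh
    rw [hu, ← ENNReal.ofReal_mul (hlam k).le,
      ← ENNReal.ofReal_mul (mul_nonneg (hmu k).le hτ.le),
      ← ENNReal.ofReal_add (mul_nonneg (mul_nonneg (hmu k).le hτ.le) hΥ) (mul_nonneg hτ.le hg)]
    refine ENNReal.ofReal_le_ofReal ?_
    suffices hs : lam k * r ≤
        mu k * (A.p k (l - 1) / h k + A.gam k l * (r - A.rho k (l - 1)) / h k) +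
          A.gain mu lam h by
      have := mul_le_mul_of_nonneg_left hs hτ.le
      linarith
    have e1 := A.mode_le_gain (lam := lam) (hmu k) (hh k) (by omega : l - 1 ≤ A.M k)
    have e2 := A.mode_le_gain (lam := lam) (hmu k) (hh k) hlM
    have e3 := A.p_succ (k := k) (l := l - 1) (by omega)
    have e4 := A.rho_lt k (l - 1) (by omega)
    rw [Nat.sub_add_cancel hl1] at e3 e4
    rw [e3] at e2
    set a := A.rho k (l - 1)
    set b := A.rho k l
    have e5 : mu k * (A.p k (l - 1) + A.gam k l * (b - a)) / h k =
        mu k * A.p k (l - 1) / h k + mu k * A.gam k l / h k * (b - a) := by ring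
    have e6 : mu k * (A.p k (l - 1) / h k + A.gam k l * (r - a) / h k) =
        mu k * A.p k (l - 1) / h k + mu k * A.gam k l / h k * (r - a) := by ring
    rw [e5] at e2
    rw [e6]
    -- On a segment `Υ` is affine, so the bound is the combination of the two mode bounds with
    -- weights `b - r` and `r - a`, divided by `b - a`.
    have f1 := mul_le_mul_of_nonneg_left e1 (sub_nonneg.2 hrl)
    have f2 := mul_le_mul_of_nonneg_left e2 (sub_nonneg.2 hlr)
    have f3 : 0 < b - a := sub_pos.2 e4
    refine le_of_mul_le_mul_left ?_ f3
    linarith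
  · have hu : A.upsilon k (h k) r = ⊤ := by simp [upsilon, hM]
    rw [hu, ENNReal.mul_top (by simpa using mul_pos (hmu k) hτ)]
    simp

theorem sum_le_allocCost_add_gain (hmu : ∀ k, 0 < mu k)
    (hlam : ∀ k, 0 < lam k) (hpos : ∀ᵐ h ∂F, ∀ k, 0 < h k) {r τ : UserVec K → UserVec K}
    (hf : IsFeasibleAlloc F R r τ) :
    ∑ k, ENNReal.ofReal (lam k) * ENNReal.ofReal (R k) ≤
      A.allocCost F mu r τ + ∫⁻ h, ENNReal.ofReal (A.gain mu lam h) ∂F := by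
  refine A.sum_le_lintegral_add_gain (y := fun h k => ENNReal.ofReal (τ h k * r h k))
    (fun k => ?_) ?_ hf.rate_le
  · exact (((measurable_pi_apply k).comp hf.measurable_time).mul
      ((measurable_pi_apply k).comp hf.measurable_rate)).ennreal_ofReal.aemeasurable
  · filter_upwards [hpos] with h hh
    have hg := A.gain_nonneg (lam := lam) hmu hh
    have h1 : ENNReal.ofReal (A.gain mu lam h) =
        ∑ k, ENNReal.ofReal (τ h k * A.gain mu lam h) := by
      rw [← ENNReal.ofReal_sum_of_nonneg fun k _ => mul_nonneg (hf.time_nonneg h hh k) hg,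
        ← Finset.sum_mul, hf.sum_eq_one h hh, one_mul]
    rw [h1, ← Finset.sum_add_distrib]
    exact Finset.sum_le_sum fun k _ =>
      A.mul_rate_le hmu hlam hh (hf.time_nonneg h hh k) (hf.rate_nonneg h hh k)

theorem userTime_mul_greedyRate (hh : ∀ k, 0 < h k) (ht : A.IsGreedy mu lam t) :
    A.userTime t h k * A.greedyRate mu lam h k = A.stateRate t h k := by
  rw [stateRate, ht.sum_mul hh, ht.userTime_eq hh]
  by_cases hb : A.IsBest mu lam h k
  · rw [greedyRate, if_pos hb]
  · rw [ht.time_eq_zero hh hb]; simp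

theorem userTime_mul_upsilon (hmu : ∀ k, 0 < mu k) (hh : ∀ k, 0 < h k)
    (ht : A.IsGreedy mu lam t) :
    ENNReal.ofReal (mu k * A.userTime t h k) * A.upsilon k (h k) (A.greedyRate mu lam h k) =
      ENNReal.ofReal (A.statePower mu t h k) := by
  have h2 : ∀ l, mu k * (t h k l / h k) * A.p k l = t h k l * (mu k * A.p k l / h k) :=
    fun l => by ring
  have h0 := ht.1.userTime_nonneg hh k
  simp only [statePower, h2]
  rw [ht.sum_mul hh k fun l => mu k * A.p k l / h k]
  rw [ht.userTime_eq hh] at h0 ⊢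
  by_cases hb : A.IsBest mu lam h k
  · rw [greedyRate, if_pos hb, A.upsilon_rho A.lstar_le_M,
      ← ENNReal.ofReal_mul (mul_nonneg (hmu k).le h0)]
    congr 1
    ring
  · rw [ht.time_eq_zero hh hb]; simp

/-- The induced allocation has the cost of the greedy policy, and both problems obey the same dual
bound. -/
theorem isOptimalAlloc_of_isGreedy [IsProbabilityMeasure F] (hmu : ∀ k, 0 < mu k)
    (hlam : ∀ k, 0 < lam k) (hpos : ∀ᵐ h ∂F, ∀ k, 0 < h k) (ht : A.IsGreedy mu lam t)
    (hR : ∀ k, A.avgRate F t k = R k) :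
    A.IsOptimalAlloc F mu R (A.greedyRate mu lam) (A.userTime t) := by
  have hcost : A.allocCost F mu (A.greedyRate mu lam) (A.userTime t) = A.modeCost F mu t := by
    rw [A.modeCost_eq_lintegral ht.1]
    refine lintegral_congr_ae ?_
    filter_upwards [hpos] with h hh
    exact Finset.sum_congr rfl fun k _ => A.userTime_mul_upsilon hmu hh ht
  refine ⟨⟨measurable_pi_lambda _ fun k => A.measurable_greedyRate k, A.measurable_userTime ht.1,
    fun h _ k => A.greedyRate_nonneg, fun h hh k => ht.1.userTime_nonneg hh k,
    fun h hh => ht.1.sum_userTime hh, fun k => ?_⟩, ?_, fun r' τ' hf => ?_⟩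
  · rw [← hR k, A.ofReal_avgRate hpos ht.1]
    refine (lintegral_congr_ae ?_).le
    filter_upwards [hpos] with h hh
    rw [A.userTime_mul_greedyRate hh ht]
  · rw [hcost]
    exact (A.isOptimalModes_of_isGreedy hmu hlam hpos ht hR).2.1
  · have h1 := A.modeCost_add_gain hmu hlam hpos ht
    simp only [hR] at h1
    have h2 := A.sum_le_allocCost_add_gain hmu hlam hpos hf
    rw [← h1] at h2
    rw [hcost]
    exact (ENNReal.add_le_add_iff_right (A.lintegral_gain_ne_top hmu hlam hpos)).1 h2

end AMCModes

/-! ### Convex functions have a unique subgradient almost everywhere -/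

/-- A convex function is locally Lipschitz on an open set, so Rademacher's theorem applies near each
point; nullity is a local property. -/
theorem ConvexOn.ae_differentiableAt {E : Type*} [NormedAddCommGroup E] [NormedSpace ℝ E]
    [FiniteDimensional ℝ E] [MeasurableSpace E] [BorelSpace E] {ν : Measure E}
    [ν.IsAddHaarMeasure] {s : Set E} {f : E → ℝ} (hf : ConvexOn ℝ s f) (hs : IsOpen s) :
    ∀ᵐ x ∂ν, x ∈ s → DifferentiableAt ℝ f x := by
  suffices hnull : ν {x | x ∈ s ∧ ¬ DifferentiableAt ℝ f x} = 0 by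
    filter_upwards [measure_eq_zero_iff_ae_notMem.1 hnull] with x hx hxs
    by_contra hd
    exact hx ⟨hxs, hd⟩
  refine measure_null_of_locally_null _ fun x hx => ?_
  obtain ⟨C, t, ht, hC⟩ := hf.locallyLipschitzOn hs hx.1
  rw [hs.nhdsWithin_eq hx.1] at ht
  refine ⟨interior t ∩ {x | x ∈ s ∧ ¬ DifferentiableAt ℝ f x},
    inter_mem (mem_nhdsWithin_of_mem_nhds (interior_mem_nhds.2 ht)) self_mem_nhdsWithin, ?_⟩
  rw [measure_eq_zero_iff_ae_notMem]
  filter_upwards [hC.ae_differentiableWithinAt_of_mem (μ := ν)] with y hy hmem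
  exact hmem.2.2 ((hy (interior_subset hmem.1)).differentiableAt
    (mem_interior_iff_mem_nhds.1 hmem.1))

/-- If a real function on an open convex set has a subgradient everywhere, then this is unique
almost everywhere. -/
theorem ae_existsUnique_subgradient {ι : Type*} [Fintype ι] {s : Set (ι → ℝ)} (hs : IsOpen s)
    (hconv : Convex ℝ s) {f : (ι → ℝ) → ℝ} {P : (ι → ℝ) → (ι → ℝ) → Prop}
    (hex : ∀ x ∈ s, ∃ a, P x a)
    (hsub : ∀ x ∈ s, ∀ a, P x a → ∀ y ∈ s, f x + ∑ k, a k * (y k - x k) ≤ f y) :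
    ∀ᵐ x, x ∈ s → ∃! a, P x a := by
  classical
  have hf : ConvexOn ℝ s f := by
    refine ⟨hconv, fun x hx y hy a b ha hb hab => ?_⟩
    have hz := hconv hx hy ha hb hab
    obtain ⟨c, hc⟩ := hex _ hz
    have h1 := mul_le_mul_of_nonneg_left (hsub _ hz c hc x hx) ha
    have h2 := mul_le_mul_of_nonneg_left (hsub _ hz c hc y hy) hb
    -- The subgradient terms cancel because the displacements from the convex combination average to
    -- zero.
    have h3 : a * ∑ k, c k * (x k - (a • x + b • y) k) +
        b * ∑ k, c k * (y k - (a • x + b • y) k) = 0 := by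
      rw [Finset.mul_sum, Finset.mul_sum, ← Finset.sum_add_distrib]
      refine Finset.sum_eq_zero fun k _ => ?_
      simp only [Pi.add_apply, Pi.smul_apply, smul_eq_mul]
      obtain rfl : b = 1 - a := by linarith
      ring
    have h4 : a * f (a • x + b • y) + b * f (a • x + b • y) = f (a • x + b • y) := by
      rw [← add_mul, hab, one_mul]
    simp only [smul_eq_mul]
    linarith
  filter_upwards [hf.ae_differentiableAt (ν := volume) hs] with x hx hxs
  have key : ∀ a, P x a → ∀ k, a k = fderiv ℝ f x (Pi.single k 1) := by
    intro a ha k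
    let ℓ : (ι → ℝ) →L[ℝ] ℝ := ∑ k, a k • ContinuousLinearMap.proj (R := ℝ) (φ := fun _ => ℝ) k
    have hℓ : ∀ y, ℓ y = ∑ k, a k * y k := fun y => by simp [ℓ]
    -- Subtracting the affine support leaves a minimum at `x`, so a subgradient at a point of
    -- differentiability is the derivative.
    have hmin : IsLocalMin (fun y => f y - ℓ y) x := by
      filter_upwards [hs.mem_nhds hxs] with y hy
      have := hsub x hxs a ha y hy
      simp only [mul_sub, Finset.sum_sub_distrib] at this
      rw [hℓ, hℓ]
      linarith
    have h0 := hmin.hasFDerivAt_eq_zero ((hx hxs).hasFDerivAt.fun_sub ℓ.hasFDerivAt)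
    rw [sub_eq_zero.1 h0, hℓ]
    simp [Pi.single_apply]
  obtain ⟨a, ha⟩ := hex x hxs
  exact ⟨a, ha, fun b hb => funext fun k => (key b hb k).trans (key a ha k).symm⟩

namespace AMCModes

variable {K : ℕ} (A : AMCModes K) {mu lam lam' h h' : UserVec K} {k : Fin K} {l m : ℕ}
  {F : Measure (UserVec K)} {R : UserVec K} {t : UserVec K → Fin K → ℕ → ℝ}

/-! ### The average rates as functions of the weights -/

theorem meanRate_le_meanRate [IsProbabilityMeasure F] (hmu : ∀ k, 0 < mu k)
    (hpos : ∀ᵐ h ∂F, ∀ k, 0 < h k) (hk : lam k ≤ lam' k) (hj : ∀ j ≠ k, lam' j ≤ lam j) :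
    A.meanRate F mu lam k ≤ A.meanRate F mu lam' k := by
  refine integral_mono_ae A.integrable_greedyRate A.integrable_greedyRate ?_
  filter_upwards [hpos] with h hh using A.greedyRate_le_greedyRate hmu hh hk hj

theorem meanRate_eq_zero (hmu : ∀ k, 0 < mu k) (hpos : ∀ᵐ h ∂F, ∀ k, 0 < h k) (hk : lam k = 0) :
    A.meanRate F mu lam k = 0 := by
  refine integral_eq_zero_of_ae ?_
  filter_upwards [hpos] with h hh
  have h0 : A.lstar mu lam h k = 0 := by
    rw [A.lstar_eq_zero_iff (hmu k) (hh k), hk]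
    exact div_pos (mul_pos (hmu k) (A.gam_pos le_rfl (A.one_le_M k))) (hh k)
  simp [greedyRate, h0, A.rho_zero]

variable {A} in
-- All threshold comparisons are strict in a regular state, and there are finitely many, so they
-- survive small changes of the weights.
theorem IsRegular.eventually_lstar_eq (hreg : A.IsRegular mu lam h) (k : Fin K) :
    ∀ᶠ lam' in 𝓝 lam, A.lstar mu lam' h k = A.lstar mu lam h k := by
  have h1 : ∀ l ∈ Finset.Icc 1 (A.M k), ∀ᶠ lam' : UserVec K in 𝓝 lam,
      (mu k * A.gam k l / h k ≤ lam' k ↔ mu k * A.gam k l / h k ≤ lam k) := by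
    intro l hl
    rw [Finset.mem_Icc] at hl
    have hc : Tendsto (fun lam' : UserVec K => lam' k) (𝓝 lam) (𝓝 (lam k)) :=
      (continuous_apply k).tendsto lam
    rcases lt_or_gt_of_ne (hreg.threshold_ne k l hl.1 hl.2) with hlt | hlt
    · filter_upwards [hc.eventually_const_lt hlt] with lam' h'
      exact ⟨fun _ => hlt.le, fun _ => h'.le⟩
    · filter_upwards [hc.eventually_lt_const hlt] with lam' h'
      exact ⟨fun hle => absurd hle h'.not_ge, fun hle => absurd hle hlt.not_ge⟩
  filter_upwards [(Finset.eventually_all _).2 h1] with lam' h'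
  rw [lstar, lstar, Finset.filter_congr h']

variable {A} in
theorem IsRegular.continuousAt_quality (hreg : A.IsRegular mu lam h) (k : Fin K) :
    ContinuousAt (fun lam => A.quality mu lam h k) lam := by
  have h1 : (fun lam' : UserVec K => mu k * A.p k (A.lstar mu lam h k) / h k -
      lam' k * A.rho k (A.lstar mu lam h k)) =ᶠ[𝓝 lam] fun lam' => A.quality mu lam' h k := by
    filter_upwards [hreg.eventually_lstar_eq k] with lam' h'
    rw [quality, h']
  exact (continuous_const.sub ((continuous_apply k).mul continuous_const)).continuousAt.congr h1

variable {A} in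
-- The rate is locally constant in the weights: a best user of negative quality is strictly best and
-- keeps its mode, a best user of quality zero remains silent whether or not it stays best, and a
-- user that is not best remains so.
theorem IsRegular.continuousAt_greedyRate (hmu : ∀ k, 0 < mu k) (hreg : A.IsRegular mu lam h)
    (k : Fin K) : ContinuousAt (fun lam => A.greedyRate mu lam h k) lam := by
  refine ContinuousAt.congr (f := fun _ => A.greedyRate mu lam h k) continuousAt_const ?_
  by_cases hb : A.IsBest mu lam h k
  · rcases (A.quality_nonpos (lam := lam) (hmu k) (hreg.pos k)).eq_or_lt with h0 | hneg
    · have hl := A.lstar_eq_zero_of_quality (hmu k) (hreg.pos k) h0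
        (hreg.threshold_ne k 1 le_rfl (A.one_le_M k))
      filter_upwards [hreg.eventually_lstar_eq k] with lam' h'
      simp [greedyRate, h', hl, A.rho_zero]
    · have h1 : ∀ j, ∀ᶠ lam' in 𝓝 lam, A.quality mu lam' h k ≤ A.quality mu lam' h j := by
        intro j
        by_cases hjk : k = j
        · exact Eventually.of_forall fun _ => by rw [hjk]
        · filter_upwards [(hreg.continuousAt_quality k).eventually_lt
            (hreg.continuousAt_quality j)
            (lt_of_le_of_ne (hb j) (hreg.quality_ne k j hjk hneg))] with lam' h' using h'.le
      filter_upwards [eventually_all.2 h1, hreg.eventually_lstar_eq k] with lam' hb' h'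
      have hb' : A.IsBest mu lam' h k := hb'
      rw [greedyRate, greedyRate, if_pos hb, if_pos hb', h']
  · obtain ⟨j, hj⟩ := not_forall.1 hb
    filter_upwards [(hreg.continuousAt_quality j).eventually_lt
      (hreg.continuousAt_quality k) (not_le.1 hj)] with lam' h'
    rw [greedyRate, greedyRate, if_neg hb, if_neg fun hb' => (hb' j).not_gt h']

/-- Dominated convergence. The exceptional null set depends on `lam`, which is harmless since
continuity is checked at one point at a time. -/
theorem continuous_meanRate [IsProbabilityMeasure F] (hmu : ∀ k, 0 < mu k)
    (hF_nonneg : ∀ᵐ h ∂F, ∀ k, 0 ≤ h k) (hF_cont : F ≪ volume) (k : Fin K) :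
    Continuous fun lam => A.meanRate F mu lam k := by
  rw [continuous_iff_continuousAt]
  intro lam
  refine continuousAt_of_dominated (bound := fun _ => A.rhoMax k) ?_ ?_ (integrable_const _) ?_
  · exact Eventually.of_forall fun _ => (A.measurable_greedyRate k).aestronglyMeasurable
  · refine Eventually.of_forall fun _ => Eventually.of_forall fun h => ?_
    rw [Real.norm_of_nonneg A.greedyRate_nonneg]
    exact A.greedyRate_le
  · filter_upwards [A.ae_isRegular hmu hF_nonneg hF_cont lam] with h hreg
    exact hreg.continuousAt_greedyRate hmu k

/-! ### Large weights -/

theorem exists_measurableSet_forall_le [IsProbabilityMeasure F] (hpos : ∀ᵐ h ∂F, ∀ k, 0 < h k)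
    {ε : ℝ} (hε : 0 < ε) :
    ∃ δ > 0, MeasurableSet {h : UserVec K | ∀ k, δ ≤ h k} ∧
      1 - ε < F.real {h : UserVec K | ∀ k, δ ≤ h k} := by
  let G : ℕ → Set (UserVec K) := fun n => {h | ∀ k, 1 / ((n : ℝ) + 1) ≤ h k}
  have hm : ∀ δ : ℝ, MeasurableSet {h : UserVec K | ∀ k, δ ≤ h k} := fun δ => by
    simp only [Set.ofPred_forall]
    exact MeasurableSet.iInter fun k => measurableSet_le measurable_const (measurable_pi_apply k)
  have hmono : Monotone G := fun m n hmn h hh k =>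
    (Nat.one_div_le_one_div hmn).trans (hh k)
  have hU : F (⋃ n, G n) = 1 := by
    rw [← measure_univ (μ := F)]
    refine measure_congr ?_
    filter_upwards [hpos] with h hh
    refine propext ⟨fun _ => trivial, fun _ => ?_⟩
    have h1 : ∀ k, ∀ᶠ n : ℕ in atTop, 1 / ((n : ℝ) + 1) ≤ h k := fun k =>
      (tendsto_one_div_add_atTop_nhds_zero_nat.eventually_lt_const (hh k)).mono fun _ => le_of_lt
    obtain ⟨n, hn⟩ := (eventually_all.2 h1).exists
    exact Set.mem_iUnion.2 ⟨n, hn⟩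
  have ht := tendsto_measure_iUnion_atTop (μ := F) hmono
  rw [hU] at ht
  have ht' := (ENNReal.tendsto_toReal ENNReal.one_ne_top).comp ht
  obtain ⟨n, hn⟩ := (ht'.eventually_const_lt
    (show 1 - ε < (1 : ℝ≥0∞).toReal by simpa using hε)).exists
  exact ⟨1 / ((n : ℝ) + 1), by positivity, hm _, hn⟩

/-- Outside a set of small probability, the best users have almost the largest products of weight
and top rate, and they transmit in their top modes if these products are large. -/
theorem exists_measurableSet_isBest [IsProbabilityMeasure F] (hmu : ∀ k, 0 < mu k)
    (hpos : ∀ᵐ h ∂F, ∀ k, 0 < h k) {ε : ℝ} (hε : 0 < ε) :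
    ∃ C > 0, ∃ G : Set (UserVec K), MeasurableSet G ∧ 1 - ε < F.real G ∧
      ∀ h ∈ G, ∀ lam : UserVec K, (∀ k, 0 ≤ lam k) → ∀ k, A.IsBest mu lam h k →
        (∀ j, lam j * A.rhoMax j - C ≤ lam k * A.rhoMax k) ∧
        (C ≤ lam k * A.rhoMax k → A.lstar mu lam h k = A.M k) := by
  obtain ⟨δ, hδ, hm, hF⟩ := exists_measurableSet_forall_le hpos hε
  -- When all gains are at least `δ`, the first term bounds the weighted power of the top mode, and
  -- the second the top threshold times the top rate.
  let a : Fin K → ℝ := fun k =>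
    mu k * A.p k (A.M k) / δ + mu k * A.gam k (A.M k) / δ * A.rhoMax k
  have hp : ∀ k, 0 < A.p k (A.M k) := fun k => A.p_pos k _ (A.one_le_M k) le_rfl
  have hg : ∀ k, 0 < A.gam k (A.M k) := fun k => A.gam_pos (A.one_le_M k) le_rfl
  have hr := A.rhoMax_pos
  have h1 : ∀ k, 0 < mu k * A.p k (A.M k) / δ := fun k => div_pos (mul_pos (hmu k) (hp k)) hδ
  have h2 : ∀ k, 0 < mu k * A.gam k (A.M k) / δ * A.rhoMax k := fun k =>
    mul_pos (div_pos (mul_pos (hmu k) (hg k)) hδ) (hr k)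
  have ha : ∀ k ∈ Finset.univ, 0 ≤ a k := fun k _ => (add_pos (h1 k) (h2 k)).le
  have hle : ∀ k, a k < 1 + ∑ k, a k := fun k => by
    have := Finset.single_le_sum ha (Finset.mem_univ k)
    linarith
  refine ⟨1 + ∑ k, a k, by linarith [Finset.sum_nonneg ha], _, hm, hF,
    fun h hh lam hlam k hb => ⟨fun j => ?_, fun hC => ?_⟩⟩
  · have hh' : ∀ k, 0 < h k := fun k => hδ.trans_le (hh k)
    have e1 := A.neg_mul_rhoMax_le_quality (hmu k) (hh' k) (hlam k)
    have e2 := hb j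
    have e3 : A.quality mu lam h j ≤ mu j * A.p j (A.M j) / h j - lam j * A.rhoMax j :=
      A.quality_le (hmu j) (hh' j) le_rfl
    have e4 : mu j * A.p j (A.M j) / h j ≤ mu j * A.p j (A.M j) / δ :=
      div_le_div_of_nonneg_left (mul_pos (hmu j) (hp j)).le hδ (hh j)
    have e5 := hle j
    have e6 := h2 j
    have e7 : a j = mu j * A.p j (A.M j) / δ + mu j * A.gam j (A.M j) / δ * A.rhoMax j := rfl
    linarith
  · refine le_antisymm A.lstar_le_M (A.le_lstar (A.one_le_M k) le_rfl ?_)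
    have e4 : mu k * A.gam k (A.M k) / h k ≤ mu k * A.gam k (A.M k) / δ :=
      div_le_div_of_nonneg_left (mul_pos (hmu k) (hg k)).le hδ (hh k)
    refine e4.trans (le_of_mul_le_mul_right ?_ (hr k))
    have e5 := hle k
    have e6 := h1 k
    have e7 : a k = mu k * A.p k (A.M k) / δ + mu k * A.gam k (A.M k) / δ * A.rhoMax k := rfl
    linarith

end AMCModes

/-! ### Monotone response maps -/

/-- A response map assigns to nonnegative weights `x` a rate `r x k` of every user `k`; the rate is
continuous, nondecreasing in the user's own weight, nonincreasing in the other weights, and zero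
at weight zero. -/
structure IsResponse {ι : Type*} (r : (ι → ℝ) → ι → ℝ) : Prop where
  continuous : ∀ k, Continuous fun x => r x k
  le_of_le : ∀ x y k, x k ≤ y k → (∀ j ≠ k, y j ≤ x j) → r x k ≤ r y k
  eq_zero : ∀ x k, x k = 0 → r x k = 0

namespace IsResponse

variable {ι : Type*} {r : (ι → ℝ) → ι → ℝ} {R : ι → ℝ}

/-- The complementarity problem for a response map is solvable in every box. -/
theorem exists_mem_Icc [Fintype ι] [DecidableEq ι] (hr : IsResponse r)
    {L V : ι → ℝ} (hLV : L ≤ V) (R : ι → ℝ) :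
    ∃ x ∈ Set.Icc L V, ∀ k, (x k = V k ∨ R k ≤ r x k) ∧ (x k = L k ∨ r x k ≤ R k) := by
  -- `S` keeps the half of the complementarity conditions that survives raising another coordinate;
  -- a point of `S` with maximal coordinate sum satisfies the other half.
  let S : Set (ι → ℝ) := Set.Icc L V ∩ {x | ∀ k, x k = L k ∨ r x k ≤ R k}
  have hclosed : IsClosed {x : ι → ℝ | ∀ k, x k = L k ∨ r x k ≤ R k} := by
    simp only [Set.ofPred_forall, Set.ofPred_or]
    exact isClosed_iInter fun k => (isClosed_eq (continuous_apply k) continuous_const).union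
      (isClosed_le (hr.continuous k) continuous_const)
  have hS : IsCompact S := isCompact_Icc.inter_right hclosed
  obtain ⟨x, ⟨hx, hxS⟩, hmax⟩ := hS.exists_isMaxOn (f := fun x : ι → ℝ => ∑ k, x k)
    ⟨L, ⟨le_rfl, hLV⟩, fun k => Or.inl rfl⟩ (by fun_prop)
  refine ⟨x, hx, fun k => ⟨?_, hxS k⟩⟩
  by_contra! hcon
  -- If the rate of `k` is too low below the upper bound, `x k` can be raised slightly: by
  -- continuity `k` stays below its target, the other rates only drop, and the sum grows within `S`.
  have hlt : x k < V k := lt_of_le_of_ne (hx.2 k) hcon.1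
  have hc : ContinuousAt (fun s => r (Function.update x k s) k) (x k) :=
    ((hr.continuous k).comp (continuous_const.update k continuous_id)).continuousAt
  have h1 : ∀ᶠ s in 𝓝 (x k), r (Function.update x k s) k < R k :=
    hc.eventually_lt_const (by simpa using hcon.2)
  obtain ⟨s, ⟨hs1, hs2⟩, hs3⟩ :=
    (Filter.Eventually.and (Ioo_mem_nhdsGT hlt : ∀ᶠ s in 𝓝[>] x k, s ∈ Set.Ioo (x k) (V k))
      (h1.filter_mono nhdsWithin_le_nhds)).exists
  have hle : x ≤ Function.update x k s := le_update_iff.2 ⟨hs1.le, fun _ _ => le_rfl⟩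
  have hmem : Function.update x k s ∈ S := by
    refine ⟨⟨hx.1.trans hle, update_le_iff.2 ⟨hs2.le, fun j _ => hx.2 j⟩⟩, fun j => ?_⟩
    by_cases hj : j = k
    · subst hj
      exact Or.inr hs3.le
    · rw [Function.update_of_ne hj]
      refine (hxS j).imp_right fun h => (hr.le_of_le _ _ j ?_ fun i _ => hle i).trans h
      rw [Function.update_of_ne hj]
  have h2 : ∑ j, Function.update x k s j ≤ ∑ j, x j := hmax hmem
  have h3 : ∑ j, x j < ∑ j, Function.update x k s j :=
    Finset.sum_lt_sum (fun j _ => hle j) ⟨k, Finset.mem_univ k, by simpa using hs1⟩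
  exact h3.not_ge h2

theorem pos_of_eq (hr : IsResponse r) (hR : ∀ k, 0 < R k) {x : ι → ℝ} (hx : 0 ≤ x)
    (heq : ∀ k, r x k = R k) (k : ι) : 0 < x k := by
  refine lt_of_le_of_ne (hx k) fun h0 => ?_
  have := hr.eq_zero x k h0.symm
  rw [heq k] at this
  exact (hR k).ne' this

/-- Below every supersolution there is a solution. -/
theorem exists_eq_le [Fintype ι] [DecidableEq ι] (hr : IsResponse r)
    (hR : ∀ k, 0 < R k) {v : ι → ℝ} (hv : 0 ≤ v)
    (hle : ∀ k, R k ≤ r v k) : ∃ x ≤ v, (∀ k, 0 < x k) ∧ ∀ k, r x k = R k := by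
  obtain ⟨x, ⟨hx0, hxv⟩, hx⟩ := hr.exists_mem_Icc hv R
  have heq : ∀ k, r x k = R k := by
    refine fun k => le_antisymm ?_ ?_
    · refine (hx k).2.elim (fun h0 => ?_) id
      rw [hr.eq_zero x k h0]
      exact (hR k).le
    · exact (hx k).1.elim
        (fun h0 => (hle k).trans (hr.le_of_le _ _ k h0.ge fun j _ => hxv j)) id
  exact ⟨x, hxv, hr.pos_of_eq hR hx0 heq, heq⟩

/-- Above every subsolution there is a solution, if there are large enough supersolutions. -/
theorem exists_eq_ge [Fintype ι] [DecidableEq ι] (hr : IsResponse r)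
    (hR : ∀ k, 0 < R k)
    (hup : ∀ L : ι → ℝ, 0 ≤ L → ∃ x ≥ L, ∀ k, R k ≤ r x k)
    {u : ι → ℝ} (hu : 0 ≤ u) (hle : ∀ k, r u k ≤ R k) :
    ∃ x ≥ u, (∀ k, 0 < x k) ∧ ∀ k, r x k = R k := by
  obtain ⟨V, hV, hVR⟩ := hup u hu
  obtain ⟨x, ⟨hxu, hxV⟩, hx⟩ := hr.exists_mem_Icc hV R
  have heq : ∀ k, r x k = R k := by
    refine fun k => le_antisymm ?_ ?_
    · exact (hx k).2.elim
        (fun h0 => (hr.le_of_le _ _ k h0.le fun j _ => hxu j).trans (hle k)) id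
    · exact (hx k).1.elim
        (fun h0 => (hVR k).trans (hr.le_of_le _ _ k h0.ge fun j _ => hxV j)) id
  exact ⟨x, hxu, hr.pos_of_eq hR (hu.trans hxu) heq, heq⟩

/-- Intermediate value theorem between weight 0 and the weight of `k` in a supersolution above `x`;
lowering the other weights to those of `x` only helps `k`. -/
theorem exists_update_eq [DecidableEq ι] (hr : IsResponse r)
    (hR : ∀ k, 0 < R k)
    (hup : ∀ L : ι → ℝ, 0 ≤ L → ∃ x ≥ L, ∀ k, R k ≤ r x k) {x : ι → ℝ} (hx : 0 ≤ x) (k : ι) :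
    ∃ s > 0, r (Function.update x k s) k = R k := by
  obtain ⟨y, hy, hyR⟩ := hup x hx
  have hyk : 0 ≤ y k := (hx k).trans (hy k)
  have hc : Continuous fun s => r (Function.update x k s) k :=
    (hr.continuous k).comp (continuous_const.update k continuous_id)
  have h0 : r (Function.update x k 0) k = 0 := hr.eq_zero _ k (by simp)
  have h1 : R k ≤ r (Function.update x k (y k)) k :=
    (hyR k).trans (hr.le_of_le _ _ k (by simp) fun j hj => by simpa [hj] using hy j)
  obtain ⟨s, hs, hsR⟩ := intermediate_value_Icc hyk hc.continuousOn
    (⟨h0.le.trans (hR k).le, h1⟩ : R k ∈ Set.Icc _ _)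
  refine ⟨s, lt_of_le_of_ne hs.1 ?_, hsR⟩
  rintro rfl
  simp only [h0] at hsR
  exact (hR k).ne hsR

theorem exists_run [DecidableEq ι] (hr : IsResponse r)
    (hR : ∀ k, 0 < R k)
    (hup : ∀ L : ι → ℝ, 0 ≤ L → ∃ x ≥ L, ∀ k, R k ≤ r x k) {x : ι → ℝ} (hx : ∀ k, 0 < x k) :
    ∃ s : ℕ → ι → ℝ, s 0 = x ∧
      ∀ n k, 0 < s (n + 1) k ∧ r (Function.update (s n) k (s (n + 1) k)) k = R k := by
  have hstep : ∀ y : {y : ι → ℝ // ∀ k, 0 < y k}, ∀ k,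
      ∃ s > 0, r (Function.update y.1 k s) k = R k := fun y k =>
    hr.exists_update_eq hR hup (fun k => (y.2 k).le) k
  choose f hf0 hf using hstep
  let g : {y : ι → ℝ // ∀ k, 0 < y k} → {y : ι → ℝ // ∀ k, 0 < y k} := fun y => ⟨f y, hf0 y⟩
  refine ⟨fun n => (g^[n] ⟨x, hx⟩).1, rfl, fun n k => ?_⟩
  simp only [Function.iterate_succ_apply']
  exact ⟨hf0 _ k, hf _ k⟩

/-! ### Runs of the simultaneous iteration -/

variable {s : ℕ → ι → ℝ}

/-- An update above `V k`, made against weights of the others below `V`, would give user `k` at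
least its rate at `V`, which exceeds the target. -/
theorem run_le [DecidableEq ι] (hr : IsResponse r)
    {V : ι → ℝ} (hV : ∀ k, R k < r V k) (h0 : s 0 ≤ V)
    (hs : ∀ n k, r (Function.update (s n) k (s (n + 1) k)) k = R k) (n : ℕ) : s n ≤ V := by
  induction n with
  | zero => exact h0
  | succ n ih =>
    intro k
    by_contra hcon
    have := hr.le_of_le V (Function.update (s n) k (s (n + 1) k)) k
      (by simpa using (not_le.1 hcon).le) fun j hj => by simpa [hj] using ih j
    rw [hs n k] at this
    exact (hV k).not_ge this

/-- The upper limit of a bounded run is a subsolution. -/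
theorem limsup_le [Fintype ι] [DecidableEq ι] (hr : IsResponse r)
    {V : ι → ℝ} (h0 : ∀ n, 0 ≤ s n) (hV : ∀ n, s n ≤ V)
    (hs : ∀ n k, r (Function.update (s n) k (s (n + 1) k)) k = R k) (k : ι) :
    r (fun j => limsup (fun n => s n j) atTop) k ≤ R k := by
  set u : ι → ℝ := fun j => limsup (fun n => s n j) atTop with hu
  have hb : ∀ j, atTop.IsBoundedUnder (· ≤ ·) fun n => s n j := fun j =>
    isBoundedUnder_of ⟨V j, fun n => hV n j⟩
  have hcb : ∀ j, atTop.IsCoboundedUnder (· ≤ ·) fun n => s n j := fun j =>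
    (isBoundedUnder_of ⟨0, fun n => h0 n j⟩ :
      atTop.IsBoundedUnder (· ≥ ·) fun n => s n j).isCoboundedUnder_le
  have hcb' : atTop.IsCoboundedUnder (· ≤ ·) fun n => s (n + 1) k :=
    (isBoundedUnder_of ⟨0, fun n => h0 (n + 1) k⟩ :
      atTop.IsBoundedUnder (· ≥ ·) fun n => s (n + 1) k).isCoboundedUnder_le
  -- The own weight is lowered and the others are raised, so the rate at `z ε` is at most that of
  -- some late update, which is exactly `R k`; then `ε` tends to 0.
  let z : ℝ → ι → ℝ := fun ε => Function.update (fun j => u j + ε) k (u k - ε)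
  have hz : Continuous z := by
    refine Continuous.update ?_ k (by fun_prop)
    fun_prop
  have hz0 : z 0 = u := by simp [z]
  have hlim : Tendsto (fun ε => r (z ε) k) (𝓝[>] 0) (𝓝 (r u k)) := by
    have := ((hr.continuous k).comp hz).tendsto 0
    simp only [Function.comp_apply, hz0] at this
    exact this.mono_left nhdsWithin_le_nhds
  refine le_of_tendsto hlim ?_
  filter_upwards [self_mem_nhdsWithin] with ε hε
  have hε : 0 < ε := hε
  have h1 : ∀ᶠ n in atTop, ∀ j, s n j < u j + ε := eventually_all.2 fun j =>
    eventually_lt_of_limsup_lt (lt_add_of_pos_right _ hε) (hb j)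
  have h2 : ∃ᶠ n in atTop, u k - ε < s (n + 1) k := by
    refine frequently_lt_of_lt_limsup hcb' ?_
    -- The shift matters: the new weight of `k` is paired with the previous weights of the others.
    have := limsup_nat_add (fun n => s n k) 1
    rw [this]
    exact sub_lt_self _ hε
  obtain ⟨n, hn2, hn1⟩ := (h2.and_eventually h1).exists
  rw [← hs n k]
  refine hr.le_of_le _ _ k (by simpa [z] using hn2.le) fun j hj => ?_
  simpa [z, hj] using (hn1 j).le

/-- The lower limit of a bounded run is a supersolution. -/
theorem le_liminf [Fintype ι] [DecidableEq ι] (hr : IsResponse r)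
    {V : ι → ℝ} (h0 : ∀ n, 0 ≤ s n) (hV : ∀ n, s n ≤ V)
    (hs : ∀ n k, r (Function.update (s n) k (s (n + 1) k)) k = R k) (k : ι) :
    R k ≤ r (fun j => liminf (fun n => s n j) atTop) k := by
  set u : ι → ℝ := fun j => liminf (fun n => s n j) atTop with hu
  have hb : ∀ j, atTop.IsBoundedUnder (· ≥ ·) fun n => s n j := fun j =>
    isBoundedUnder_of ⟨0, fun n => h0 n j⟩
  have hcb' : atTop.IsCoboundedUnder (· ≥ ·) fun n => s (n + 1) k :=
    (isBoundedUnder_of ⟨V k, fun n => hV (n + 1) k⟩ :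
      atTop.IsBoundedUnder (· ≤ ·) fun n => s (n + 1) k).isCoboundedUnder_ge
  -- Mirror image of the perturbation used for the upper limit.
  let z : ℝ → ι → ℝ := fun ε => Function.update (fun j => u j - ε) k (u k + ε)
  have hz : Continuous z := by
    refine Continuous.update ?_ k (by fun_prop)
    fun_prop
  have hz0 : z 0 = u := by simp [z]
  have hlim : Tendsto (fun ε => r (z ε) k) (𝓝[>] 0) (𝓝 (r u k)) := by
    have := ((hr.continuous k).comp hz).tendsto 0
    simp only [Function.comp_apply, hz0] at this
    exact this.mono_left nhdsWithin_le_nhds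
  refine ge_of_tendsto hlim ?_
  filter_upwards [self_mem_nhdsWithin] with ε hε
  have hε : 0 < ε := hε
  have h1 : ∀ᶠ n in atTop, ∀ j, u j - ε < s n j := eventually_all.2 fun j =>
    eventually_lt_of_lt_liminf (sub_lt_self _ hε) (hb j)
  have h2 : ∃ᶠ n in atTop, s (n + 1) k < u k + ε := by
    refine frequently_lt_of_liminf_lt hcb' ?_
    have := liminf_nat_add (fun n => s n k) 1
    rw [this]
    exact lt_add_of_pos_right _ hε
  obtain ⟨n, hn2, hn1⟩ := (h2.and_eventually h1).exists
  rw [← hs n k]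
  refine hr.le_of_le _ _ k (by simpa [z] using hn2.le) fun j hj => ?_
  simpa [z, hj] using (hn1 j).le

/-- Simultaneous updates converge to the solution if it is unique. -/
theorem tendsto_run [Fintype ι] [DecidableEq ι] (hr : IsResponse r)
    (hR : ∀ k, 0 < R k)
    (hup : ∀ L : ι → ℝ, 0 ≤ L → ∃ x ≥ L, ∀ k, R k < r x k) {y : ι → ℝ}
    (huniq : ∀ x, (∀ k, 0 < x k) → (∀ k, r x k = R k) → x = y) (h0 : ∀ n, 0 ≤ s n)
    (hs : ∀ n k, r (Function.update (s n) k (s (n + 1) k)) k = R k) :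
    Tendsto s atTop (𝓝 y) := by
  obtain ⟨V, hV0, hV⟩ := hup (s 0) (h0 0)
  have hsV := hr.run_le hV hV0 hs
  have hb : ∀ j, atTop.IsBoundedUnder (· ≤ ·) fun n => s n j := fun j =>
    isBoundedUnder_of ⟨V j, fun n => hsV n j⟩
  have hb' : ∀ j, atTop.IsBoundedUnder (· ≥ ·) fun n => s n j := fun j =>
    isBoundedUnder_of ⟨0, fun n => h0 n j⟩
  have hv : (0 : ι → ℝ) ≤ fun j => liminf (fun n => s n j) atTop := fun j =>
    le_liminf_of_le (hb j).isCoboundedUnder_ge (Eventually.of_forall fun n => h0 n j)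
  have hu : (0 : ι → ℝ) ≤ fun j => limsup (fun n => s n j) atTop := fun j =>
    (hv j).trans (liminf_le_limsup (hb j) (hb' j))
  -- Both solutions must be `y`, whence `limsup ≤ y ≤ liminf` in every coordinate.
  obtain ⟨x, hxu, hx0, hx⟩ := hr.exists_eq_ge hR
    (fun L hL => (hup L hL).imp fun x hx => ⟨hx.1, fun k => (hx.2 k).le⟩) hu
    (hr.limsup_le h0 hsV hs)
  obtain ⟨x', hxv, hx0', hx'⟩ := hr.exists_eq_le hR hv (hr.le_liminf h0 hsV hs)
  rw [huniq x hx0 hx] at hxu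
  rw [huniq x' hx0' hx'] at hxv
  exact tendsto_pi_nhds.2 fun j =>
    tendsto_of_le_liminf_of_limsup_le (hxv j) (hxu j) (hb j) (hb' j)

end IsResponse

namespace AMCModes

variable {K : ℕ} (A : AMCModes K) {mu lam lam' h h' : UserVec K} {k : Fin K} {l m : ℕ}
  {F : Measure (UserVec K)} {R : UserVec K} {t : UserVec K → Fin K → ℕ → ℝ}

theorem isResponse_meanRate [IsProbabilityMeasure F] (hmu : ∀ k, 0 < mu k)
    (hF_nonneg : ∀ᵐ h ∂F, ∀ k, 0 ≤ h k) (hF_cont : F ≪ volume) :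
    IsResponse (A.meanRate F mu) where
  continuous := A.continuous_meanRate hmu hF_nonneg hF_cont
  le_of_le _ _ _ := A.meanRate_le_meanRate hmu (ae_forall_pos hF_nonneg hF_cont)
  eq_zero _ _ := A.meanRate_eq_zero hmu (ae_forall_pos hF_nonneg hF_cont)

/-! ### Strict feasibility -/

variable {A} in
theorem StrictlyFeasible.neZero (hf : A.StrictlyFeasible F R) : NeZero K :=
  hf.choose_spec.1.ne_zero

variable {A} in
/-- Strictly feasible rates need less than the whole block when all users use their top modes. -/
theorem StrictlyFeasible.sum_div_lt_one [IsProbabilityMeasure F] (hf : A.StrictlyFeasible F R)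
    (hpos : ∀ᵐ h ∂F, ∀ k, 0 < h k) : ∑ k, R k / A.rhoMax k < 1 := by
  obtain ⟨t, ht, hlt⟩ := hf
  have := ht.ne_zero
  have hint : ∀ k, Integrable (fun h => A.userTime t h k) F := fun k => by
    refine Integrable.of_bound
      ((measurable_pi_apply k).comp (A.measurable_userTime ht)).aestronglyMeasurable 1 ?_
    filter_upwards [hpos] with h hh
    rw [Real.norm_of_nonneg (ht.userTime_nonneg hh k)]
    exact A.userTime_le_one hh ht
  have h1 : ∀ k, R k / A.rhoMax k < ∫ h, A.userTime t h k ∂F := fun k => by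
    rw [div_lt_iff₀ (A.rhoMax_pos k), ← integral_mul_const]
    refine (hlt k).trans_le (integral_mono_ae (A.integrable_stateRate hpos ht)
      ((hint k).mul_const _) ?_)
    filter_upwards [hpos] with h hh using A.stateRate_le hh ht
  have h2 : ∑ k, ∫ h, A.userTime t h k ∂F = 1 := by
    rw [← integral_finsetSum _ fun k _ => hint k]
    have : ∫ h, ∑ k, A.userTime t h k ∂F = ∫ _, (1 : ℝ) ∂F := by
      refine integral_congr_ae ?_
      filter_upwards [hpos] with h hh using ht.sum_userTime hh
    rw [this]
    simp
  rw [← h2]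
  exact Finset.sum_lt_sum_of_nonempty ⟨0, Finset.mem_univ _⟩ fun k _ => h1 k

/-- For rates that need less than the whole block there are arbitrarily large supersolutions. -/
theorem exists_le_meanRate [IsProbabilityMeasure F] (hmu : ∀ k, 0 < mu k)
    (hF_nonneg : ∀ᵐ h ∂F, ∀ k, 0 ≤ h k) (hF_cont : F ≪ volume) (hR : ∀ k, 0 < R k)
    (hsum : ∑ k, R k / A.rhoMax k < 1) {L : UserVec K} (hL : 0 ≤ L) :
    ∃ x ≥ L, ∀ k, R k ≤ A.meanRate F mu x k := by
  have hpos := ae_forall_pos hF_nonneg hF_cont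
  rcases Nat.eq_zero_or_pos K with rfl | hK
  · exact ⟨L, le_rfl, fun k => k.elim0⟩
  have : NeZero K := ⟨hK.ne'⟩
  have hρ := A.rhoMax_pos
  -- The first bound makes `F.real G` exceed the total time demand; the second keeps a user that
  -- transmits only off `G` below its target.
  obtain ⟨ε, hε, hε1, hεR⟩ : ∃ ε > 0, ε ≤ 1 - ∑ k, R k / A.rhoMax k ∧
      ∀ k, ε ≤ R k / A.rhoMax k := by
    obtain ⟨j, hj⟩ := Finite.exists_min fun k => R k / A.rhoMax k
    exact ⟨_, lt_min (sub_pos.2 hsum) (div_pos (hR j) (hρ j)), min_le_left _ _,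
      fun k => (min_le_right _ _).trans (hj k)⟩
  obtain ⟨C, hC, G, hG, hGε, hbest⟩ := A.exists_measurableSet_isBest hmu hpos hε
  have hLρ : ∀ k ∈ Finset.univ, 0 ≤ L k * A.rhoMax k := fun k _ => mul_nonneg (hL k) (hρ k).le
  -- All products of weight and top rate are capped at `N`. Both `C` and every `L k * rhoMax k` are
  -- at most `N - C`, the latter strictly.
  set N := 2 * C + ∑ k, L k * A.rhoMax k with hN
  have hLN : ∀ k, L k * A.rhoMax k < N - C := fun k => by
    have := Finset.single_le_sum hLρ (Finset.mem_univ k)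
    linarith
  have hCN : C ≤ N - C := by linarith [Finset.sum_nonneg hLρ]
  obtain ⟨x, ⟨hxL, -⟩, hx⟩ := (A.isResponse_meanRate hmu hF_nonneg hF_cont).exists_mem_Icc
    (L := L) (V := fun k => N / A.rhoMax k)
    (fun k => by rw [le_div_iff₀ (hρ k)]; linarith [hLN k]) R
  refine ⟨x, hxL, fun k => (hx k).1.elim (fun hxk => ?_) id⟩
  -- If some user reached its cap, every best user on `G` would exceed its lower bound and send at
  -- top rate. Users at their lower bound are then never best on `G`, so no rate exceeds its target;
  -- yet the block is used at top rates with probability more than `∑ R k / rhoMax k`.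
  exfalso
  have hxk : x k * A.rhoMax k = N := by rw [hxk]; exact div_mul_cancel₀ _ (hρ k).ne'
  have hx0 : ∀ k, 0 ≤ x k := fun k => (hL k).trans (hxL k)
  have hGreal : F.real Gᶜ < ε := by
    rw [probReal_compl_eq_one_sub hG]; linarith
  have hbig : ∀ h ∈ G, ∀ w, A.IsBest mu x h w →
      L w < x w ∧ A.greedyRate mu x h w = A.rhoMax w := by
    intro h hh w hw
    obtain ⟨h1, h2⟩ := hbest h hh x hx0 w hw
    have h3 := h1 k
    rw [hxk] at h3
    refine ⟨lt_of_mul_lt_mul_right ((hLN w).trans_le h3) (hρ w).le, ?_⟩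
    rw [greedyRate, if_pos hw, h2 (hCN.trans h3), rhoMax]
  have hrate : ∀ w, A.meanRate F mu x w ≤ R w := by
    intro w
    refine (hx w).2.elim (fun hw => ?_) id
    have h1 : A.meanRate F mu x w ≤ ∫ h, Gᶜ.indicator (fun _ => A.rhoMax w) h ∂F := by
      refine integral_mono A.integrable_greedyRate
        ((integrable_const _).indicator hG.compl) fun h => ?_
      by_cases hh : h ∈ G
      · have hnb : ¬ A.IsBest mu x h w := fun hb => (hbig h hh w hb).1.ne' hw
        simp [greedyRate, hnb, hh]
      · simpa [hh] using A.greedyRate_le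
    rw [integral_indicator_const _ hG.compl, smul_eq_mul] at h1
    have h2 := mul_le_mul_of_nonneg_right (hGreal.le.trans (hεR w)) (hρ w).le
    rw [div_mul_cancel₀ _ (hρ w).ne'] at h2
    exact h1.trans h2
  have hlow : F.real G ≤ ∑ w, (A.rhoMax w)⁻¹ * A.meanRate F mu x w := by
    rw [← A.integral_sum_greedyRate fun w => (A.rhoMax w)⁻¹]
    have h1 : ∫ h, G.indicator (fun _ => (1 : ℝ)) h ∂F = F.real G := by
      rw [integral_indicator_const _ hG]; simp
    rw [← h1]
    refine integral_mono ((integrable_const _).indicator hG)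
      (integrable_finsetSum _ fun w _ => A.integrable_greedyRate.const_mul _) fun h => ?_
    have h0 : ∀ w ∈ Finset.univ, 0 ≤ (A.rhoMax w)⁻¹ * A.greedyRate mu x h w := fun w _ =>
      mul_nonneg (inv_nonneg.2 (hρ w).le) A.greedyRate_nonneg
    by_cases hh : h ∈ G
    · obtain ⟨w, hw⟩ := A.exists_isBest mu x h
      have h2 := Finset.single_le_sum h0 (Finset.mem_univ w)
      rw [(hbig h hh w hw).2, inv_mul_cancel₀ (hρ w).ne'] at h2
      simpa [hh] using h2
    · simpa [hh] using Finset.sum_nonneg h0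
  have hupp : ∑ w, (A.rhoMax w)⁻¹ * A.meanRate F mu x w ≤ ∑ w, R w / A.rhoMax w :=
    Finset.sum_le_sum fun w _ => by
      rw [div_eq_inv_mul]
      exact mul_le_mul_of_nonneg_left (hrate w) (inv_nonneg.2 (hρ w).le)
  linarith

theorem exists_lt_meanRate [IsProbabilityMeasure F] (hmu : ∀ k, 0 < mu k)
    (hF_nonneg : ∀ᵐ h ∂F, ∀ k, 0 ≤ h k) (hF_cont : F ≪ volume) (hR : ∀ k, 0 < R k)
    (hsum : ∑ k, R k / A.rhoMax k < 1) {L : UserVec K} (hL : 0 ≤ L) :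
    ∃ x ≥ L, ∀ k, R k < A.meanRate F mu x k := by
  have hρ := A.rhoMax_pos
  -- Dividing by `K + 1` instead of `K` leaves slack after every target has been raised by `c *
  -- rhoMax k`.
  set c := (1 - ∑ k, R k / A.rhoMax k) / (K + 1) with hc
  have hK : (0 : ℝ) < K + 1 := by positivity
  have hc0 : 0 < c := div_pos (sub_pos.2 hsum) hK
  have hlt : ∀ k, R k < R k + c * A.rhoMax k := fun k =>
    lt_add_of_pos_right _ (mul_pos hc0 (hρ k))
  have hsum' : ∑ k, (R k + c * A.rhoMax k) / A.rhoMax k < 1 := by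
    have h1 : ∀ k, (R k + c * A.rhoMax k) / A.rhoMax k = R k / A.rhoMax k + c := fun k => by
      rw [add_div, mul_div_cancel_right₀ _ (hρ k).ne']
    simp only [h1, Finset.sum_add_distrib, Finset.sum_const, Finset.card_univ, Fintype.card_fin,
      nsmul_eq_mul]
    have h2 : (K + 1) * c = 1 - ∑ k, R k / A.rhoMax k := mul_div_cancel₀ _ hK.ne'
    linarith
  obtain ⟨x, hx, hxR⟩ := A.exists_le_meanRate hmu hF_nonneg hF_cont
    (R := fun k => R k + c * A.rhoMax k) (fun k => (hR k).trans (hlt k)) hsum' hL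
  exact ⟨x, hx, fun k => (hlt k).trans_le (hxR k)⟩

theorem exists_isMultiplier [NeZero K] [IsProbabilityMeasure F] (hmu : ∀ k, 0 < mu k)
    (hF_nonneg : ∀ᵐ h ∂F, ∀ k, 0 ≤ h k) (hF_cont : F ≪ volume) (hR : ∀ k, 0 < R k)
    (hsum : ∑ k, R k / A.rhoMax k < 1) : ∃ lam, A.IsMultiplier F mu R lam := by
  obtain ⟨v, hv, hvR⟩ := A.exists_le_meanRate hmu hF_nonneg hF_cont hR hsum le_rfl
  obtain ⟨x, -, hx⟩ := (A.isResponse_meanRate hmu hF_nonneg hF_cont).exists_eq_le hR hv hvR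
  exact ⟨x, (A.isMultiplier_iff hmu hF_nonneg hF_cont).2 hx⟩

/-! ### Uniqueness for almost all rates -/

/-- The mean rates are a subgradient of `meanGain`; when they equal `R`, the dual function is
maximal over positive weights. -/
theorem IsMultiplier.meanGain_le [NeZero K] [IsProbabilityMeasure F] (hmu : ∀ k, 0 < mu k)
    (hF_nonneg : ∀ᵐ h ∂F, ∀ k, 0 ≤ h k) (hF_cont : F ≪ volume)
    (hl : A.IsMultiplier F mu R lam) (hlam' : ∀ k, 0 < lam' k) :
    ∑ k, lam' k * R k - A.meanGain F mu lam' ≤ ∑ k, lam k * R k - A.meanGain F mu lam := by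
  rw [A.isMultiplier_iff hmu hF_nonneg hF_cont] at hl
  have h1 := A.sum_meanRate_le_meanGain_sub hmu hF_nonneg hF_cont hl.1 hlam'
  simp only [hl.2, sub_mul, Finset.sum_sub_distrib] at h1
  linarith

theorem ae_existsUnique_isMultiplier [NeZero K] [IsProbabilityMeasure F] (hmu : ∀ k, 0 < mu k)
    (hF_nonneg : ∀ᵐ h ∂F, ∀ k, 0 ≤ h k) (hF_cont : F ≪ volume) :
    ∀ᵐ R : UserVec K, (∀ k, 0 < R k) → ∑ k, R k / A.rhoMax k < 1 →
      ∃! lam, A.IsMultiplier F mu R lam := by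
  classical
  let s : Set (UserVec K) := {R | ∀ k, 0 < R k} ∩ {R | ∑ k, R k / A.rhoMax k < 1}
  have hs : IsOpen s := by
    refine IsOpen.inter ?_ ?_
    · simp only [Set.ofPred_forall]
      exact isOpen_iInter_of_finite fun k => isOpen_lt continuous_const (continuous_apply k)
    · exact isOpen_lt (by fun_prop) continuous_const
  have hconv : Convex ℝ s := by
    rintro x ⟨hx, hx'⟩ y ⟨hy, hy'⟩ a b ha hb hab
    have hx' : ∑ k, x k / A.rhoMax k < 1 := hx'
    have hy' : ∑ k, y k / A.rhoMax k < 1 := hy'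
    rcases ha.eq_or_lt with rfl | ha
    · obtain rfl : b = 1 := by linarith
      simpa [s] using And.intro hy hy'
    refine ⟨fun k => ?_, ?_⟩
    · have h1 := mul_pos ha (hx k)
      have h2 := mul_nonneg hb (hy k).le
      simp only [Pi.add_apply, Pi.smul_apply, smul_eq_mul]
      linarith
    · have h1 : ∑ k, (a • x + b • y) k / A.rhoMax k =
          a * ∑ k, x k / A.rhoMax k + b * ∑ k, y k / A.rhoMax k := by
        rw [Finset.mul_sum, Finset.mul_sum, ← Finset.sum_add_distrib]
        refine Finset.sum_congr rfl fun k _ => ?_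
        simp only [Pi.add_apply, Pi.smul_apply, smul_eq_mul]
        ring
      show ∑ k, (a • x + b • y) k / A.rhoMax k < 1
      rw [h1]
      nlinarith
  have hex : ∀ R ∈ s, ∃ lam, A.IsMultiplier F mu R lam := fun R hR =>
    A.exists_isMultiplier hmu hF_nonneg hF_cont hR.1 hR.2
  -- The dual value. It does not depend on the chosen multiplier, since any two are maximizers of
  -- the same dual function.
  let f : UserVec K → ℝ := fun R =>
    if hR : ∃ lam, A.IsMultiplier F mu R lam
    then ∑ k, hR.choose k * R k - A.meanGain F mu hR.choose else 0
  have hf : ∀ R lam, A.IsMultiplier F mu R lam →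
      f R = ∑ k, lam k * R k - A.meanGain F mu lam := by
    intro R lam hl
    have hR : ∃ lam, A.IsMultiplier F mu R lam := ⟨lam, hl⟩
    simp only [f, dif_pos hR]
    exact le_antisymm
      (IsMultiplier.meanGain_le A hmu hF_nonneg hF_cont hl hR.choose_spec.1)
      (IsMultiplier.meanGain_le A hmu hF_nonneg hF_cont hR.choose_spec hl.1)
  have hsub : ∀ R ∈ s, ∀ lam, A.IsMultiplier F mu R lam → ∀ R' ∈ s,
      f R + ∑ k, lam k * (R' k - R k) ≤ f R' := by
    intro R _ lam hl R' hR'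
    obtain ⟨lam', hl'⟩ := hex R' hR'
    -- Using the multiplier of `R` as a trial vector in the dual problem for `R'` gives the
    -- subgradient inequality.
    have h1 := IsMultiplier.meanGain_le A hmu hF_nonneg hF_cont hl' hl.1
    rw [hf R lam hl, hf R' lam' hl']
    simp only [mul_sub, Finset.sum_sub_distrib]
    linarith
  filter_upwards [ae_existsUnique_subgradient hs hconv hex hsub] with R hR h1 h2
  exact hR ⟨h1, h2⟩

/-! ### Uniqueness for fading laws that charge all open sets -/

/-- If user `k` has a larger weight in `lam'` than in `lam`, there are states in which nobody
transmits under `lam` and only user `k` transmits under `lam'`. -/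
theorem exists_isOpen_lstar (hmu : ∀ k, 0 < mu k) (hlam : ∀ k, 0 < lam k)
    (hlt : lam k < lam' k) :
    ∃ U : Set (UserVec K), IsOpen U ∧ U.Nonempty ∧ (∀ h ∈ U, ∀ j, 0 < h j) ∧
      ∀ h ∈ U, (∀ j, A.lstar mu lam h j = 0) ∧ (∀ j ≠ k, A.lstar mu lam' h j = 0) ∧
        A.quality mu lam' h k < 0 := by
  classical
  let c : Fin K → ℝ := fun j => mu j * A.gam j 1
  have hc : ∀ j, 0 < c j := fun j => mul_pos (hmu j) (A.gam_pos le_rfl (A.one_le_M j))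
  -- The gain of `k` lies between its first thresholds under `lam'` and `lam`; the other gains are
  -- too small for transmission under either vector.
  let a : Fin K → ℝ := fun j => if j = k then c k / lam' k else 0
  let b : Fin K → ℝ := fun j => if j = k then c k / lam k else c j / max (lam j) (lam' j)
  have hm : ∀ j, 0 < max (lam j) (lam' j) := fun j => lt_max_of_lt_left (hlam j)
  have hab : ∀ j, a j < b j := fun j => by
    by_cases hj : j = k
    · simp only [a, b, hj, if_true]
      exact div_lt_div_of_pos_left (hc k) (hlam k) hlt
    · simp only [a, b, hj, if_false]
      exact div_pos (hc j) (hm j)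
  have ha : ∀ j, 0 ≤ a j := fun j => by
    by_cases hj : j = k
    · simp only [a, hj, if_true]
      exact (div_pos (hc k) ((hlam k).trans hlt)).le
    · simp [a, hj]
  have hU : ∀ h ∈ Set.pi Set.univ fun j => Set.Ioo (a j) (b j), ∀ j, 0 < h j :=
    fun h hh j => (ha j).trans_lt (hh j trivial).1
  refine ⟨Set.pi Set.univ fun j => Set.Ioo (a j) (b j),
    isOpen_set_pi Set.finite_univ fun j _ => isOpen_Ioo,
    Set.univ_pi_nonempty_iff.2 fun j => Set.nonempty_Ioo.2 (hab j), hU,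
    fun h hh => ⟨fun j => ?_, fun j hj => ?_, ?_⟩⟩
  · have hj0 := hU h hh j
    rw [A.lstar_eq_zero_iff (hmu j) hj0, lt_div_iff₀ hj0, mul_comm]
    have h1 := (hh j trivial).2
    by_cases hj : j = k
    · simp only [b, hj, if_true, lt_div_iff₀ (hlam k)] at h1
      rw [hj]
      exact h1
    · simp only [b, hj, if_false, lt_div_iff₀ (hm j)] at h1
      exact (mul_le_mul_of_nonneg_left (le_max_left _ _) hj0.le).trans_lt h1
  · have hj0 := hU h hh j
    rw [A.lstar_eq_zero_iff (hmu j) hj0, lt_div_iff₀ hj0, mul_comm]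
    have h1 := (hh j trivial).2
    simp only [b, hj, if_false, lt_div_iff₀ (hm j)] at h1
    exact (mul_le_mul_of_nonneg_left (le_max_right _ _) hj0.le).trans_lt h1
  · have hk0 := hU h hh k
    refine A.quality_neg (hmu k) hk0 ?_
    have h1 := (hh k trivial).1
    simp only [a, if_true, div_lt_iff₀ ((hlam k).trans hlt)] at h1
    rw [div_lt_iff₀ hk0, mul_comm (lam' k)]
    exact h1

theorem integral_pos_of_isOpen (hch : ChargesOpenSets F) {f : UserVec K → ℝ}
    (hf : Integrable f F) (h0 : 0 ≤ᵐ[F] f) {U : Set (UserVec K)} (hU : IsOpen U)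
    (hne : U.Nonempty) (hpos : ∀ h ∈ U, ∀ k, 0 < h k) (hfU : ∀ h ∈ U, 0 < f h) :
    0 < ∫ h, f h ∂F := by
  rw [integral_pos_iff_support_of_nonneg_ae h0 hf]
  exact (hch U hU hne hpos).trans_le (measure_mono fun h hh => (hfU h hh).ne')

/-- On an open set of states the rate of `k` jumps from zero to a positive value, and it drops
almost nowhere. -/
theorem meanRate_strictMono [IsProbabilityMeasure F] (hmu : ∀ k, 0 < mu k)
    (hpos : ∀ᵐ h ∂F, ∀ k, 0 < h k) (hch : ChargesOpenSets F) (hlam : ∀ k, 0 < lam k)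
    (hk : lam k < lam' k) (hj : ∀ j ≠ k, lam' j ≤ lam j) :
    A.meanRate F mu lam k < A.meanRate F mu lam' k := by
  obtain ⟨U, hU, hne, hUpos, hUl⟩ := A.exists_isOpen_lstar hmu hlam hk
  rw [← sub_pos, meanRate, meanRate,
    ← integral_sub A.integrable_greedyRate A.integrable_greedyRate]
  refine integral_pos_of_isOpen hch (A.integrable_greedyRate.sub A.integrable_greedyRate) ?_
    hU hne hUpos fun h hh => ?_
  · filter_upwards [hpos] with h hh
    exact sub_nonneg.2 (A.greedyRate_le_greedyRate hmu hh hk.le hj)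
  · obtain ⟨h1, h2, h3⟩ := hUl h hh
    have hb : A.IsBest mu lam' h k := fun j => by
      by_cases hjk : j = k
      · rw [hjk]
      · rw [A.quality_eq_zero (h2 j hjk)]
        exact h3.le
    have hl : 1 ≤ A.lstar mu lam' h k := by
      by_contra hcon
      exact h3.ne (A.quality_eq_zero (by omega))
    have h4 : A.greedyRate mu lam h k = 0 := by simp [greedyRate, h1, A.rho_zero]
    rw [h4, sub_zero, greedyRate, if_pos hb]
    exact A.rho_pos hl A.lstar_le_M

/-- If some `lam' k` exceeded `lam k`, there would be an open set where the gain and all rates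
vanish under `lam` but the gain is positive under `lam'`. The integrated subgradient inequality is
then strict, so `lam'` has a smaller dual value than `lam` and is no maximizer. -/
theorem IsMultiplier.le_of_chargesOpenSets [NeZero K] [IsProbabilityMeasure F]
    (hmu : ∀ k, 0 < mu k) (hF_nonneg : ∀ᵐ h ∂F, ∀ k, 0 ≤ h k) (hF_cont : F ≪ volume)
    (hch : ChargesOpenSets F) (hl : A.IsMultiplier F mu R lam)
    (hl' : A.IsMultiplier F mu R lam') : lam' ≤ lam := by
  intro k
  by_contra hcon
  obtain ⟨U, hU, hne, hUpos, hUl⟩ := A.exists_isOpen_lstar hmu hl.1 (not_le.1 hcon)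
  have hpos := ae_forall_pos hF_nonneg hF_cont
  have h1 := IsMultiplier.meanGain_le A hmu hF_nonneg hF_cont hl' hl.1
  have hr := ((A.isMultiplier_iff hmu hF_nonneg hF_cont).1 hl).2
  have hg := A.integrable_gain hmu hl.1 hpos
  have hg' := A.integrable_gain hmu hl'.1 hpos
  have hd : Integrable (fun h => A.gain mu lam' h - A.gain mu lam h) F := hg'.sub hg
  have hs : Integrable (fun h => ∑ k, (lam' k - lam k) * A.greedyRate mu lam h k) F :=
    integrable_finsetSum _ fun k _ => A.integrable_greedyRate.const_mul _
  have h2 : 0 < ∫ h, (A.gain mu lam' h - A.gain mu lam h -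
      ∑ k, (lam' k - lam k) * A.greedyRate mu lam h k) ∂F := by
    refine integral_pos_of_isOpen hch (hd.sub hs) ?_ hU hne hUpos fun h hh => ?_
    · filter_upwards [A.ae_isRegular hmu hF_nonneg hF_cont lam] with h hreg
      exact sub_nonneg.2 (A.sum_greedyRate_le_gain_sub hmu hreg lam')
    · obtain ⟨e1, -, e3⟩ := hUl h hh
      have e4 : ∀ j, A.greedyRate mu lam h j = 0 := fun j => by
        simp [greedyRate, e1, A.rho_zero]
      have e5 : A.gain mu lam h = 0 := by
        simp [gain, A.quality_eq_zero (e1 _)]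
      have e6 := A.neg_quality_le_gain mu lam' h k
      simp only [e4, e5, mul_zero, Finset.sum_const_zero, sub_zero]
      linarith
  rw [integral_sub hd hs, integral_sub hg' hg,
    A.integral_sum_greedyRate fun k => lam' k - lam k] at h2
  simp only [hr, sub_mul, Finset.sum_sub_distrib] at h2
  simp only [meanGain] at h1
  linarith

theorem existsUnique_isStep [NeZero K] [IsProbabilityMeasure F] (hmu : ∀ k, 0 < mu k)
    (hF_nonneg : ∀ᵐ h ∂F, ∀ k, 0 ≤ h k) (hF_cont : F ≪ volume) (hch : ChargesOpenSets F)
    (hR : ∀ k, 0 < R k) (hsum : ∑ k, R k / A.rhoMax k < 1) (hlam : ∀ k, 0 < lam k)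
    (k : Fin K) : ∃! x, A.IsStep F mu R lam k x := by
  have hpos := ae_forall_pos hF_nonneg hF_cont
  simp only [A.isStep_iff hmu hF_nonneg hF_cont]
  obtain ⟨x, hx⟩ := (A.isResponse_meanRate hmu hF_nonneg hF_cont).exists_update_eq hR
    (fun L hL => A.exists_le_meanRate hmu hF_nonneg hF_cont hR hsum hL)
    (fun k => (hlam k).le) k
  have hmono : ∀ y z, 0 < y → y < z → A.meanRate F mu (Function.update lam k y) k <
      A.meanRate F mu (Function.update lam k z) k := fun y z hy hyz => by
    refine A.meanRate_strictMono hmu hpos hch (fun j => ?_) (by simpa using hyz)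
      fun j hj => by simp [hj]
    by_cases hj : j = k
    · subst hj; simpa using hy
    · simpa [hj] using hlam j
  refine ⟨x, hx, fun y hy => ?_⟩
  rcases lt_trichotomy y x with hlt | heq | hgt
  · have := hmono y x hy.1 hlt
    rw [hy.2, hx.2] at this
    exact absurd this (lt_irrefl _)
  · exact heq
  · have := hmono x y hx.1 hgt
    rw [hy.2, hx.2] at this
    exact absurd this (lt_irrefl _)

end AMCModes

theorem theorem6 {K : ℕ} (A : AMCModes K) (mu : UserVec K) (hmu : ∀ k, 0 < mu k)
    (F : Measure (UserVec K)) [IsProbabilityMeasure F]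
    (hF_nonneg : ∀ᵐ h ∂F, ∀ k, 0 ≤ h k) (hF_cont : F ≪ volume) :
    -- every greedy policy of an admissible multiplier vector meets the rates and is optimal
    (∀ R lam : UserVec K, A.IsMultiplier F mu R lam → ∀ t, A.IsGreedy mu lam t →
      (∀ k, A.avgRate F t k = R k) ∧ A.IsOptimalModes F mu R t ∧
      A.IsOptimalAlloc F mu R (A.greedyRate mu lam) (A.userTime t)) ∧
    -- an admissible multiplier vector exists
    (∀ R : UserVec K, (∀ k, 0 < R k) → A.StrictlyFeasible F R →
      ∃ lam, A.IsMultiplier F mu R lam) ∧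
    -- it is unique for almost every rate vector
    (∀ᵐ R : UserVec K, (∀ k, 0 < R k) → A.StrictlyFeasible F R →
      ∃! lam, A.IsMultiplier F mu R lam) ∧
    -- it is unique for every rate vector, and so is each update of the iterative algorithm,
    -- if the fading law charges all open sets of positive states
    (ChargesOpenSets F → ∀ R : UserVec K, (∀ k, 0 < R k) → A.StrictlyFeasible F R →
      (∃! lam, A.IsMultiplier F mu R lam) ∧
      ∀ lam : UserVec K, (∀ k, 0 < lam k) → ∀ k, ∃! x, A.IsStep F mu R lam k x) ∧
    -- the iterative algorithm can be run from every positive initial vector, and it converges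
    -- to the multiplier vector whenever this is unique
    (∀ R : UserVec K, (∀ k, 0 < R k) → A.StrictlyFeasible F R →
      ∀ lam0 : UserVec K, (∀ k, 0 < lam0 k) →
        (∃ s, A.IsRun F mu R lam0 s) ∧
        ∀ lam, A.IsMultiplier F mu R lam → (∀ lam', A.IsMultiplier F mu R lam' → lam' = lam) →
          ∀ s, A.IsRun F mu R lam0 s → Tendsto s atTop (𝓝 lam)) := by
  have hpos := ae_forall_pos hF_nonneg hF_cont
  refine ⟨fun R lam hl t ht => ?_, fun R hR hf => ?_, ?_, fun hch R hR hf => ?_,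
    fun R hR hf lam0 hlam0 => ?_⟩
  · have := ht.1.ne_zero
    have hrate : ∀ k, A.avgRate F t k = R k := fun k => by
      rw [A.avgRate_eq_meanRate hmu hF_nonneg hF_cont ht,
        ((A.isMultiplier_iff hmu hF_nonneg hF_cont).1 hl).2]
    exact ⟨hrate, A.isOptimalModes_of_isGreedy hmu hl.1 hpos ht hrate,
      A.isOptimalAlloc_of_isGreedy hmu hl.1 hpos ht hrate⟩
  · have := hf.neZero
    exact A.exists_isMultiplier hmu hF_nonneg hF_cont hR (hf.sum_div_lt_one hpos)
  · rcases Nat.eq_zero_or_pos K with hK | hK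
    -- With no users there is no policy, so nothing is strictly feasible.
    · exact Eventually.of_forall fun R _ hf => absurd hK hf.neZero.ne
    · have : NeZero K := ⟨hK.ne'⟩
      filter_upwards [A.ae_existsUnique_isMultiplier hmu hF_nonneg hF_cont] with R h hR hf
      exact h hR (hf.sum_div_lt_one hpos)
  · have := hf.neZero
    have hsum := hf.sum_div_lt_one hpos
    refine ⟨?_, fun lam hlam k =>
      A.existsUnique_isStep hmu hF_nonneg hF_cont hch hR hsum hlam k⟩
    obtain ⟨lam, hl⟩ := A.exists_isMultiplier hmu hF_nonneg hF_cont hR hsum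
    exact ⟨lam, hl, fun lam' hl' => le_antisymm
      (AMCModes.IsMultiplier.le_of_chargesOpenSets A hmu hF_nonneg hF_cont hch hl hl')
      (AMCModes.IsMultiplier.le_of_chargesOpenSets A hmu hF_nonneg hF_cont hch hl' hl)⟩
  · have := hf.neZero
    have hsum := hf.sum_div_lt_one hpos
    have hr := A.isResponse_meanRate hmu hF_nonneg hF_cont
    simp only [AMCModes.IsRun, A.isStep_iff hmu hF_nonneg hF_cont,
      A.isMultiplier_iff hmu hF_nonneg hF_cont]
    refine ⟨hr.exists_run hR
      (fun L hL => A.exists_le_meanRate hmu hF_nonneg hF_cont hR hsum hL) hlam0, ?_⟩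
    rintro lam - huniq s ⟨hs0, hs⟩
    refine hr.tendsto_run hR
      (fun L hL => A.exists_lt_meanRate hmu hF_nonneg hF_cont hR hsum hL)
      (fun x hx hxR => huniq x ⟨hx, hxR⟩) (fun n => ?_) fun n k => (hs n k).2
    cases n with
    | zero => rw [hs0]; exact fun k => (hlam0 k).le
    | succ n => exact fun k => (hs n k).1.le
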